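/- All Banach spaces are real. A *twisted sum* of Banach spaces $Y$ and $X$ is a Banach space $Z$ for which there is a short exact sequence $0\to Y\to Z\to X\to 0$ of Banach spaces and continuous linear operators. A *Lindenstrauss space* is a Banach space whose dual is isometrically isomorphic to $L_1(\mu)$ for some measure $\mu$. A series $\sum_n x_n$ in a Banach space $Z$ is *weakly unconditionally Cauchy* if $\sum_n |f(x_n)|<\infty$ for every $f\in Z^*$; an operator on $Z$ is *unconditionally converging* if it maps every such series to an unconditionally convergent one; and $Z$ has *Pełczyński's property $(V)$* if every unconditionally converging operator from $Z$ into a Banach space is weakly compact. **Theorem.** Let $X$ be a Lindenstrauss space and let $Z$ be a twisted sum of $c_0$ and $X$. Then $Z$ is (linearly) isomorphic to a Lindenstrauss space $W$, and $W$ can be chosen so that its dual $W^*$ is isometrically isomorphic to $\ell_1\oplus_1 X^*$. Consequently, $Z$ has Pełczyński's property $(V)$. -/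

import Mathlib

open MeasureTheory
open scoped ZeroAtInfty

universe u v w t

/-- `0 → Y → Z → X → 0`, with the continuous linear maps `j : Y → Z` and `p : Z → X`, is a short
exact sequence: the kernel of each arrow is the image of the preceding one. -/
structure IsShortExactSeq {Y Z X : Type*}
    [NormedAddCommGroup Y] [NormedSpace ℝ Y] [NormedAddCommGroup Z] [NormedSpace ℝ Z]
    [NormedAddCommGroup X] [NormedSpace ℝ X] (j : Y →L[ℝ] Z) (p : Z →L[ℝ] X) : Prop where
  injective : Function.Injective j
  exact : Function.Exact j p
  surjective : Function.Surjective p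

/-- The Banach space `Z` is a twisted sum of `Y` and `X`: it is the middle term of a short exact
sequence `0 → Y → Z → X → 0` of Banach spaces and operators. -/
def IsTwistedSum (Y X Z : Type*)
    [NormedAddCommGroup Y] [NormedSpace ℝ Y] [CompleteSpace Y]
    [NormedAddCommGroup X] [NormedSpace ℝ X] [CompleteSpace X]
    [NormedAddCommGroup Z] [NormedSpace ℝ Z] [CompleteSpace Z] : Prop :=
  ∃ (j : Y →L[ℝ] Z) (p : Z →L[ℝ] X), IsShortExactSeq j p

/-- A (real) Banach space `X` is a Lindenstrauss space (an `L₁`-predual) if its dual is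
isometrically isomorphic to `L₁(μ)` for some measure `μ`, with no finiteness restriction. -/
def IsLindenstrauss (X : Type u) [NormedAddCommGroup X] [NormedSpace ℝ X] [CompleteSpace X] :
    Prop :=
  ∃ (Ω : Type v) (_ : MeasurableSpace Ω) (μ : Measure Ω),
    Nonempty (StrongDual ℝ X ≃ₗᵢ[ℝ] Lp ℝ 1 μ)

/-- The series `∑ xₙ` is weakly unconditionally Cauchy: `∑ |f (xₙ)| < ∞` for all `f` in the
dual. -/
def IsWeaklyUnconditionallyCauchy {X : Type*} [NormedAddCommGroup X] [NormedSpace ℝ X]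
    (x : ℕ → X) : Prop :=
  ∀ f : StrongDual ℝ X, Summable fun n => |f (x n)|

/-- An operator is unconditionally converging if it maps weakly unconditionally Cauchy series to
unconditionally convergent series (`Summable` is unconditional convergence in norm). -/
def IsUnconditionallyConverging {X Y : Type*} [NormedAddCommGroup X] [NormedSpace ℝ X]
    [NormedAddCommGroup Y] [NormedSpace ℝ Y] (T : X →L[ℝ] Y) : Prop :=
  ∀ x : ℕ → X, IsWeaklyUnconditionallyCauchy x → Summable fun n => T (x n)

/-- An operator is weakly compact if the image of the closed unit ball is relatively compact in
the weak topology. -/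
def IsWeaklyCompactOperator {X Y : Type*} [NormedAddCommGroup X] [NormedSpace ℝ X]
    [NormedAddCommGroup Y] [NormedSpace ℝ Y] (T : X →L[ℝ] Y) : Prop :=
  IsCompact (closure (toWeakSpace ℝ Y '' (T '' Metric.closedBall (0 : X) 1)))

/-- Pełczyński's property (V): every unconditionally converging operator from `X` into a Banach
space is weakly compact. -/
def HasPropertyV (X : Type u) [NormedAddCommGroup X] [NormedSpace ℝ X] [CompleteSpace X] : Prop :=
  ∀ (Y : Type t) [NormedAddCommGroup Y] [NormedSpace ℝ Y] [CompleteSpace Y] (T : X →L[ℝ] Y),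
    IsUnconditionallyConverging T → IsWeaklyCompactOperator T

/-!
A twisted sum `0 → c₀ → Z → X → 0` is renormed so that `c₀` becomes an `M`-ideal. The coordinate
functionals of `c₀` extend to bounded functionals `f n` on `Z`, and `max ‖p z‖ (ε * ⨆ n, |f n z|)`
is an equivalent norm on `Z` for every `ε > 0`. If `ε` is small, the quotient norm on `X` is the
original one (`IsShortExactSeq.exists_renorming`). A lift of a vector of `X` then has coordinates
in `ℓ∞`, and changing finitely many of them within the unit ball keeps it in the unit ball; hence
a functional on the renormed space `W` splits into its restriction to `c₀` and a functional on
`X`, with the norms adding up (`IsSupNormExtension.nonempty_dual_linearIsometryEquiv`). So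
`W* = ℓ₁ ⊕₁ X*`, which is an `L¹` space over the disjoint union of `ℕ` and the measure space of
`X`.

Property (V) is proved for every Banach space `X` with `X* = L¹(μ)` (`hasPropertyV_of_dual_L1`),
without reducing to separable spaces or to spaces `C(K)`. If an operator `T` on `X` is not weakly
compact, there are `x n` in the unit ball and functionals `f m` of norm at most one such that
`f m (T (x n))` is zero for `n < m` and greater than `θ > 0` for `n ≥ m`
(`exists_seq_of_not_isCompact_closure`). The functionals `f m ∘ T` lie in an `L`-summand of `X*`
isometric to `L¹(ν)` with `ν` finite (`exists_isLProjection_onto_finite`), so they are given by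
functions `k m` in `L¹(ν)`, and the vectors of `X` act on `L¹(ν)` through bounded densities.

* If the `k m` are uniformly integrable, they are almost bounded, and convex blocks of the `x n`
  with densities close in `L²(ν)` contradict the separation
  (`not_separated_of_uniformly_integrable`).
* Otherwise a subsequence has mass bounded below on disjoint sets
  (`exists_disjoint_of_not_uniformly_integrable`). Signs supported on these sets are elements of
  the bidual whose signed sums are bounded. Local reflexivity (`local_reflexivity_sum_abs`) brings
  finitely many of them at a time into `X`, and an inductive selection of one of many candidates
  (`IsExtendable.exists_cons`) yields a weakly unconditionally Cauchy series `∑ z n` in `X` with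
  `‖T (z n)‖` bounded below. Thus `T` is not unconditionally converging.
-/

/-! ### Local reflexivity, James's sequences and convex blocks -/

section
variable {X : Type*} [NormedAddCommGroup X] [NormedSpace ℝ X]

/-- Helly's lemma without a norm bound: finitely many functionals cannot distinguish an element of
the bidual from a suitable vector. -/
theorem exists_forall_apply_eq_bidual {ι : Type*} [Finite ι] (φ : ι → StrongDual ℝ X)
    (g : StrongDual ℝ (StrongDual ℝ X)) : ∃ y : X, ∀ i, φ i y = g (φ i) := by
  classical
  have := Fintype.ofFinite ι
  let S : X →ₗ[ℝ] (ι → ℝ) := LinearMap.pi fun i => (φ i).toLinearMap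
  suffices h : (fun i => g (φ i)) ∈ LinearMap.range S by
    obtain ⟨y, hy⟩ := h
    exact ⟨y, fun i => congrFun hy i⟩
  by_contra hv
  obtain ⟨c, hc, hc'⟩ := Submodule.exists_le_ker_of_notMem hv
  have hcv : ∀ v : ι → ℝ, c v = ∑ i, v i * c (Pi.single i 1) := fun v => by
    conv_lhs => rw [pi_eq_sum_univ' v]
    simp
  have h0 : ∑ i, c (Pi.single i 1) • φ i = 0 := by
    ext x
    have : c (S x) = 0 := hc' ⟨x, rfl⟩
    rw [hcv] at this
    simpa [S, mul_comm] using this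
  apply hc
  rw [hcv]
  have := congrArg g h0
  simpa [mul_comm] using this

theorem exists_norm_lt_mul_norm_le (φ : StrongDual ℝ X) {M ε : ℝ} (hM : 0 ≤ M) (hε : 0 < ε) :
    ∃ v : X, ‖v‖ < M + ε ∧ M * ‖φ‖ ≤ φ v := by
  by_cases h : ‖φ‖ = 0
  · exact ⟨0, by simp; linarith, by simp [h]⟩
  have hp : 0 < ‖φ‖ := lt_of_le_of_ne (norm_nonneg _) (Ne.symm h)
  have hlt : M * ‖φ‖ / (M + ε) < ‖φ‖ := by
    rw [div_lt_iff₀ (by linarith)]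
    nlinarith
  obtain ⟨x, hx, hx'⟩ := φ.exists_lt_apply_of_lt_opNorm hlt
  rw [div_lt_iff₀ (by linarith)] at hx'
  rcases abs_choice (φ x) with h1 | h1
  · refine ⟨(M + ε) • x, ?_, ?_⟩
    · rw [norm_smul, Real.norm_of_nonneg (by linarith)]
      nlinarith
    · rw [Real.norm_eq_abs, h1] at hx'
      simp only [map_smul, smul_eq_mul]; linarith
  · refine ⟨-((M + ε) • x), ?_, ?_⟩
    · rw [norm_neg, norm_smul, Real.norm_of_nonneg (by linarith)]
      nlinarith
    · rw [Real.norm_eq_abs, h1] at hx'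
      simp only [map_neg, map_smul, smul_eq_mul]; linarith

/-- A finite-dimensional form of the principle of local reflexivity. Finitely many linear
constraints `‖b s + ∑ j, a s j • g j‖ ≤ M` on elements `g j` of the bidual can be realized, up to
`ε`, by vectors `y j` which moreover agree with `g j` on a prescribed functional `F j`. -/
theorem local_reflexivity {σ κ : Type*} [Fintype σ] [Fintype κ] (b : σ → X) (a : σ → κ → ℝ)
    (g : κ → StrongDual ℝ (StrongDual ℝ X)) (F : κ → StrongDual ℝ X) {M ε : ℝ} (hM : 0 ≤ M)
    (hε : 0 < ε) (h : ∀ s f, f (b s) + ∑ j, a s j * g j f ≤ M * ‖f‖) :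
    ∃ y : κ → X, (∀ s, ‖b s + ∑ j, a s j • y j‖ < M + ε) ∧ ∀ j, F j (y j) = g j (F j) := by
  classical
  let A : Set (σ → X) :=
    {v | ∃ y : κ → X, (∀ j, F j (y j) = g j (F j)) ∧ ∀ s, v s = b s + ∑ j, a s j • y j}
  let B : Set (σ → X) := Metric.ball 0 (M + ε)
  by_cases hd : Disjoint B A
  -- A functional separating `B` from `A` is tested at a point of `A` where the functionals `Ψ s`
  -- take the same values on `y j` as `g j` does; there it is at most `M * ∑ s, ‖Ψ s‖`. But in the
  -- open ball `B`, whose radius is greater than `M`, it is not bounded by this value.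
  · exfalso
    have hA : Convex ℝ A := by
      rintro v ⟨y, hy, hv⟩ v' ⟨y', hy', hv'⟩ p q hp hq hpq
      refine ⟨fun j => p • y j + q • y' j, fun j => ?_, fun s => ?_⟩
      · simp only [map_add, map_smul, hy, hy', smul_eq_mul]
        rw [← add_mul, hpq, one_mul]
      · simp only [Pi.add_apply, Pi.smul_apply, hv, hv', smul_add, Finset.smul_sum,
          Finset.sum_add_distrib]
        have : b s = p • b s + q • b s := by rw [← add_smul, hpq, one_smul]
        conv_rhs => rw [this]
        simp only [smul_comm p, smul_comm q]
        abel
    obtain ⟨Φ, r, h1, h2⟩ := geometric_hahn_banach_open (convex_ball (0 : σ → X) (M + ε))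
      Metric.isOpen_ball hA hd
    let Ψ : σ → StrongDual ℝ X := fun s => Φ.comp (ContinuousLinearMap.single ℝ (fun _ => X) s)
    have hΦ : ∀ v : σ → X, Φ v = ∑ s, Ψ s (v s) := fun v => by
      conv_lhs => rw [← Finset.univ_sum_single v]
      rw [map_sum]
      rfl
    have hy : ∀ j, ∃ y : X, ∀ i : Option σ, (i.elim (F j) Ψ) y = g j (i.elim (F j) Ψ) :=
      fun j => exists_forall_apply_eq_bidual (fun i : Option σ => i.elim (F j) Ψ) (g j)
    choose y hy using hy
    have hr : r ≤ ∑ s, M * ‖Ψ s‖ := by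
      refine (h2 (fun s => b s + ∑ j, a s j • y j) ⟨y, fun j => hy j none, fun s => rfl⟩).trans ?_
      rw [hΦ]
      refine Finset.sum_le_sum fun s _ => ?_
      refine le_trans (le_of_eq ?_) (h s (Ψ s))
      simp only [map_add, map_sum, map_smul, smul_eq_mul]
      congr 1
      exact Finset.sum_congr rfl fun j _ => congrArg (a s j * ·) (hy j (some s))
    choose v hv hv' using fun s => exists_norm_lt_mul_norm_le (Ψ s) hM hε
    have h3 := h1 v (by simpa [pi_norm_lt_iff (by linarith : 0 < M + ε)] using hv)
    rw [hΦ] at h3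
    exact absurd (Finset.sum_le_sum fun s (_ : s ∈ Finset.univ) => hv' s)
      (not_le.2 (h3.trans_le hr))
  · obtain ⟨v, hv, y, hy, hvy⟩ := Set.not_disjoint_iff.1 hd
    refine ⟨y, fun s => ?_, hy⟩
    rw [← hvy]
    exact (norm_le_pi_norm v s).trans_lt (by simpa [B] using hv)

/-- Local reflexivity for bounds on `∑ |f (x i)| + ∑ |f (y j)|`, that is, on the norms of all
signed sums of the vectors. The value `0` of `SignType` as a coefficient is harmless. -/
theorem local_reflexivity_sum_abs {ι κ : Type*} [Fintype ι] [Fintype κ] (x : ι → X)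
    (g : κ → StrongDual ℝ (StrongDual ℝ X)) (F : κ → StrongDual ℝ X) {M ε : ℝ} (hM : 0 ≤ M)
    (hε : 0 < ε) (h : ∀ f : StrongDual ℝ X, ∑ i, |f (x i)| + ∑ j, |g j f| ≤ M * ‖f‖) :
    ∃ y : κ → X, (∀ f : StrongDual ℝ X, ∑ i, |f (x i)| + ∑ j, |f (y j)| ≤ (M + ε) * ‖f‖) ∧
      ∀ j, F j (y j) = g j (F j) := by
  classical
  have hsg : ∀ (s : SignType) (a : ℝ), (s : ℝ) * a ≤ |a| := fun s a => by
    rcases s with _ | _ | _ <;> simp [le_abs_self, neg_le_abs]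
  obtain ⟨y, hy, hF⟩ := local_reflexivity
    (fun s : (ι → SignType) × (κ → SignType) => ∑ i, ((s.1 i : SignType) : ℝ) • x i)
    (fun s j => ((s.2 j : SignType) : ℝ)) g F hM hε (fun s f => by
      refine le_trans ?_ (h f)
      simp only [map_sum, map_smul, smul_eq_mul]
      exact add_le_add (Finset.sum_le_sum fun i _ => hsg _ _)
        (Finset.sum_le_sum fun i _ => hsg _ _))
  refine ⟨y, fun f => ?_, hF⟩
  have h1 := hy (fun i => SignType.sign (f (x i)), fun j => SignType.sign (f (y j)))
  have h2 := f.le_opNorm (∑ i, ((SignType.sign (f (x i)) : SignType) : ℝ) • x i +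
    ∑ j, ((SignType.sign (f (y j)) : SignType) : ℝ) • y j)
  simp only [map_add, map_sum, map_smul, smul_eq_mul, sign_mul_self] at h2
  have h3 := le_trans (Real.le_norm_self _) h2
  refine h3.trans ?_
  rw [mul_comm]
  exact mul_le_mul_of_nonneg_right h1.le (norm_nonneg _)
end

section
variable {Y : Type*} [NormedAddCommGroup Y] [NormedSpace ℝ Y]

open NormedSpace in
/-- If `F` in the bidual of `Y` stays at distance more than `θ` from `Y`, then some functional in
the unit ball vanishes at given finitely many vectors and is sent above `θ` by `F`: otherwise a
Hahn–Banach extension of `F` from the common annihilator differs from `F` by a vector of `Y`. -/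
theorem exists_dual_annihilating_of_bidual {F : StrongDual ℝ (StrongDual ℝ Y)} {θ : ℝ}
    (hθ : 0 < θ)
    (hF : ∀ y : Y, θ < ‖F - inclusionInDoubleDual ℝ Y y‖) {ι : Type*} [Finite ι] (y : ι → Y) :
    ∃ f : StrongDual ℝ Y, ‖f‖ ≤ 1 ∧ (∀ i, f (y i) = 0) ∧ θ < F f := by
  by_contra! hcon
  let E : Submodule ℝ (StrongDual ℝ Y) :=
    ⨅ i, LinearMap.ker (inclusionInDoubleDual ℝ Y (y i)).toLinearMap
  have hE : ∀ f : StrongDual ℝ Y, f ∈ E ↔ ∀ i, f (y i) = 0 := fun f => by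
    simp [E, Submodule.mem_iInf, LinearMap.mem_ker]
  have hb : ∀ f ∈ E, |F f| ≤ θ * ‖f‖ := by
    intro f hf
    by_cases h0 : ‖f‖ = 0
    · have : f = 0 := norm_eq_zero.1 h0
      simp [this]
    have hp : 0 < ‖f‖ := lt_of_le_of_ne (norm_nonneg _) (Ne.symm h0)
    have key : ∀ g ∈ E, ‖g‖ = ‖f‖ → F g ≤ θ * ‖f‖ := by
      intro g hg hgf
      have := hcon (‖f‖⁻¹ • g) (by rw [norm_smul, norm_inv, norm_norm, hgf, inv_mul_cancel₀ h0])
        (fun i => by simp [(hE g).1 hg i])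
      rw [map_smul, smul_eq_mul, inv_mul_le_iff₀ hp] at this
      linarith
    refine abs_le.2 ⟨?_, key f hf rfl⟩
    have := key (-f) (E.neg_mem hf) (norm_neg f)
    rw [map_neg] at this
    linarith
  obtain ⟨G, hG, hG'⟩ := exists_extension_norm_eq E (F.comp E.subtypeL)
  have hGθ : ‖G‖ ≤ θ := by
    rw [hG']
    exact ContinuousLinearMap.opNorm_le_bound _ hθ.le fun f => hb f f.2
  have hmem : (F - G).toLinearMap ∈ Submodule.span ℝ
      (Set.range fun i => (inclusionInDoubleDual ℝ Y (y i)).toLinearMap) := by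
    refine mem_span_of_iInf_ker_le_ker fun f hf => ?_
    have := hG ⟨f, hf⟩
    simp only [LinearMap.mem_ker]
    simp only [ContinuousLinearMap.coe_comp, Function.comp_apply, Submodule.subtypeL_apply] at this
    simp [this]
  have := Fintype.ofFinite ι
  obtain ⟨c, hc⟩ := (Submodule.mem_span_range_iff_exists_fun ℝ).1 hmem
  have hFG : F - inclusionInDoubleDual ℝ Y (∑ i, c i • y i) = G := by
    ext f
    have := LinearMap.congr_fun hc f
    simp at this
    simp [this]
  have := hF (∑ i, c i • y i)
  rw [hFG] at this
  linarith

open NormedSpace in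
/-- James's sequences: a bounded set which is not relatively weakly compact contains vectors `y n`
for which there are functionals `f m` of norm at most one that vanish at `y n` for `n < m` and
exceed a fixed `θ > 0` there for `n ≥ m`. -/
theorem exists_seq_of_not_isCompact_closure [CompleteSpace Y] {D : Set Y}
    (hb : Bornology.IsBounded D) (hD : ¬ IsCompact (closure (toWeakSpace ℝ Y '' D))) :
    ∃ θ > 0, ∃ (f : ℕ → StrongDual ℝ Y) (y : ℕ → Y), (∀ n, ‖f n‖ ≤ 1) ∧ (∀ n, y n ∈ D) ∧
      (∀ m n, n < m → f m (y n) = 0) ∧ ∀ m n, m ≤ n → θ < f m (y n) := by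
  have hr : ¬ closure (inclusionInDoubleDualWeak ℝ Y '' (toWeakSpace ℝ Y '' D)) ⊆
      Set.range (inclusionInDoubleDualWeak ℝ Y) := fun h => hD
    (isCompact_closure_of_isBounded ℝ Y _
      (by rwa [Set.preimage_image_eq _ (toWeakSpace ℝ Y).injective]) h)
  -- `F` lies in the weak-star closure of the set, but not in `Y`.
  obtain ⟨F, hF, hFr⟩ := Set.not_subset.1 hr
  let F' : StrongDual ℝ (StrongDual ℝ Y) := WeakDual.toStrongDual F
  have hcl : IsClosed (Set.range (inclusionInDoubleDual ℝ Y)) := by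
    have : Isometry (inclusionInDoubleDual ℝ Y) :=
      (inclusionInDoubleDualLi (𝕜 := ℝ) (E := Y)).isometry
    exact this.isClosedEmbedding.isClosed_range
  have hF' : F' ∉ Set.range (inclusionInDoubleDual ℝ Y) := by
    rintro ⟨y, hy⟩
    exact hFr ⟨toWeakSpace ℝ Y y, hy⟩
  have hd := (hcl.notMem_iff_infDist_pos ⟨_, Set.mem_range_self 0⟩).1 hF'
  set d := Metric.infDist F' (Set.range (inclusionInDoubleDual ℝ Y))
  have hdist : ∀ y : Y, d / 2 < ‖F' - inclusionInDoubleDual ℝ Y y‖ := fun y => by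
    refine (half_lt_self hd).trans_le
      ((Metric.infDist_le_dist_of_mem (Set.mem_range_self y)).trans_eq (dist_eq_norm_sub F' _))
  obtain ⟨s, hs, hs'⟩ := exists_seq_of_forall_finset_exists
    (α := StrongDual ℝ Y × Y)
    (fun a => ‖a.1‖ ≤ 1 ∧ a.2 ∈ D ∧ d / 2 < F' a.1 ∧ d / 2 < a.1 a.2)
    (fun a b => b.1 a.2 = 0 ∧ d / 2 < a.1 b.2) (by
      intro s hs
      obtain ⟨f, hf1, hf2, hf3⟩ := exists_dual_annihilating_of_bidual (half_pos hd) hdist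
        (fun a : s => a.1.2)
      have hopen : IsOpen {G : WeakDual ℝ (StrongDual ℝ Y) |
          d / 2 < G f ∧ ∀ a ∈ s, d / 2 < G a.1} := by
        have h1 : ∀ f : StrongDual ℝ Y, IsOpen {G : WeakDual ℝ (StrongDual ℝ Y) | d / 2 < G f} :=
          fun f => isOpen_lt continuous_const (WeakDual.eval_continuous f)
        refine (h1 f).inter ?_
        have : {G : WeakDual ℝ (StrongDual ℝ Y) | ∀ a ∈ s, d / 2 < G a.1} =
          ⋂ a ∈ s, {G : WeakDual ℝ (StrongDual ℝ Y) | d / 2 < G a.1} := by ext; simp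
        change IsOpen {G : WeakDual ℝ (StrongDual ℝ Y) | ∀ a ∈ s, d / 2 < G a.1}
        rw [this]
        exact isOpen_biInter_finset fun a _ => h1 a.1
      obtain ⟨_, ⟨hG1, hG2⟩, _, ⟨y, hyD, rfl⟩, rfl⟩ := mem_closure_iff.1 hF _ hopen
        ⟨hf3, fun a ha => (hs a ha).2.2.1⟩
      exact ⟨(f, y), ⟨hf1, hyD, hf3, hG1⟩, fun a ha => ⟨hf2 ⟨a, ha⟩, hG2 a ha⟩⟩)
  refine ⟨d / 2, half_pos hd, fun n => (s n).1, fun n => (s n).2, fun n => (hs n).1,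
    fun n => (hs n).2.1, fun m n h => (hs' n m h).1, fun m n h => ?_⟩
  rcases h.eq_or_lt with rfl | h
  · exact (hs m).2.2.2
  · exact (hs' m n h).2

end

/-- A bounded sequence in an inner product space has consecutive convex blocks as close as
desired: by the parallelogram law it suffices that both have almost minimal norm among the convex
combinations of a tail. -/
theorem exists_convexHull_norm_sub_lt {H : Type*} [NormedAddCommGroup H] [InnerProductSpace ℝ H]
    {u : ℕ → H} {C : ℝ} (hC : ∀ n, ‖u n‖ ≤ C) {ε : ℝ} (hε : 0 < ε) :
    ∃ p, ∃ z ∈ convexHull ℝ (u '' Set.Iio p), ∃ z' ∈ convexHull ℝ (u '' Set.Ici p),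
      ‖z - z'‖ < ε := by
  have hC0 : 0 ≤ C := (norm_nonneg _).trans (hC 0)
  let S : ℕ → Set ℝ := fun n => norm '' convexHull ℝ (u '' Set.Ici n)
  have hne : ∀ n, ‖u n‖ ∈ S n := fun n =>
    ⟨u n, subset_convexHull ℝ _ ⟨n, le_refl n, rfl⟩, rfl⟩
  have hbdd : ∀ n, BddBelow (S n) := fun n => ⟨0, by rintro _ ⟨z, _, rfl⟩; exact norm_nonneg z⟩
  have hanti : ∀ {m n}, m ≤ n → S n ⊆ S m := fun h =>
    Set.image_mono (convexHull_mono (Set.image_mono (Set.Ici_subset_Ici.2 h)))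
  have hdC : ∀ n, sInf (S n) ≤ C := fun n => (csInf_le (hbdd n) (hne n)).trans (hC n)
  have hbddD : BddAbove (Set.range fun n => sInf (S n)) :=
    ⟨C, by rintro _ ⟨n, rfl⟩; exact hdC n⟩
  set D := ⨆ n, sInf (S n) with hD
  have hdD : ∀ n, sInf (S n) ≤ D := fun n => le_ciSup hbddD n
  have hDC : D ≤ C := ciSup_le hdC
  have hD0 : 0 ≤ D :=
    (Real.sInf_nonneg (by rintro _ ⟨z, _, rfl⟩; exact norm_nonneg z)).trans (hdD 0)
  obtain ⟨δ, hδ, hδ1, hδε⟩ : ∃ δ > 0, δ ≤ 1 ∧ δ * (16 * C + 4) < ε ^ 2 := by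
    refine ⟨min 1 (ε ^ 2 / (16 * C + 5)), by positivity, min_le_left _ _, ?_⟩
    have h1 : min 1 (ε ^ 2 / (16 * C + 5)) ≤ ε ^ 2 / (16 * C + 5) := min_le_right _ _
    rw [le_div_iff₀ (by positivity)] at h1
    have : 0 < min 1 (ε ^ 2 / (16 * C + 5)) := by positivity
    nlinarith
  have near : ∀ n, ∃ z ∈ convexHull ℝ (u '' Set.Ici n), ‖z‖ < D + δ := fun n => by
    obtain ⟨_, ⟨z, hz, rfl⟩, hlt⟩ := exists_lt_of_csInf_lt ⟨_, hne n⟩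
      ((hdD n).trans_lt (lt_add_of_pos_right D hδ))
    exact ⟨z, hz, hlt⟩
  obtain ⟨n, hn⟩ := exists_lt_of_lt_ciSup (sub_lt_self D hδ)
  obtain ⟨z, hz, hzD⟩ := near n
  obtain ⟨p, hnp, hp⟩ : ∃ p, n ≤ p ∧ z ∈ convexHull ℝ (u '' Set.Iio p) := by
    rw [convexHull_eq_union_convexHull_finite_subsets] at hz
    simp only [Set.mem_iUnion] at hz
    obtain ⟨t, ht, hz⟩ := hz
    have : ∀ a : t, ∃ i, u i = a := fun a => by
      obtain ⟨i, _, hi⟩ := ht a.2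
      exact ⟨i, hi⟩
    choose i hi using this
    obtain ⟨B, hB⟩ := (Set.finite_range i).bddAbove
    refine ⟨max n (B + 1), le_max_left _ _, convexHull_mono ?_ hz⟩
    intro a ha
    exact ⟨i ⟨a, ha⟩, lt_of_lt_of_le (Nat.lt_succ_of_le (hB ⟨_, rfl⟩)) (le_max_right _ _), hi _⟩
  obtain ⟨z', hz', hzD'⟩ := near p
  refine ⟨p, z, hp, z', hz', ?_⟩
  have hmid : sInf (S n) ≤ ‖(1 / 2 : ℝ) • z + (1 / 2 : ℝ) • z'‖ :=
    csInf_le (hbdd n) ⟨_, convex_convexHull ℝ _ hz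
      (convexHull_mono (Set.image_mono (Set.Ici_subset_Ici.2 hnp)) hz')
      (by norm_num) (by norm_num) (by norm_num), rfl⟩
  rw [← smul_add, norm_smul, Real.norm_of_nonneg (by norm_num)] at hmid
  have hpar := parallelogram_law_with_norm ℝ z z'
  have hw : D ^ 2 - 2 * D * δ ≤ (1 / 2 * ‖z + z'‖) ^ 2 := by
    rcases le_total δ D with h | h
    · nlinarith [norm_nonneg (z + z')]
    · nlinarith [sq_nonneg (1 / 2 * ‖z + z'‖)]
  have h1 : ‖z‖ ^ 2 ≤ (D + δ) ^ 2 := pow_le_pow_left₀ (norm_nonneg _) hzD.le 2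
  have h2 : ‖z'‖ ^ 2 ≤ (D + δ) ^ 2 := pow_le_pow_left₀ (norm_nonneg _) hzD'.le 2
  refine lt_of_pow_lt_pow_left₀ 2 hε.le ?_
  nlinarith [mul_le_mul_of_nonneg_right hDC hδ.le, mul_le_mul_of_nonneg_right hδ1 hδ.le]

/-! ### Densities of functionals on `L¹` -/

section
variable {Ω : Type*} [MeasurableSpace Ω] {ν : Measure Ω}

/-- The functional `k ↦ ∫ b k` on `L¹`, for a bounded function `b`. -/
noncomputable def integralMulL1 (b : Ω → ℝ) (hb : AEStronglyMeasurable b ν) (C : ℝ)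
    (hC : ∀ᵐ x ∂ν, ‖b x‖ ≤ C) : StrongDual ℝ (Lp ℝ 1 ν) :=
  LinearMap.mkContinuous
    { toFun := fun k => ∫ x, b x * k x ∂ν
      map_add' := fun k l => by
        rw [← integral_add ((L1.integrable_coeFn k).bdd_mul hb hC)
          ((L1.integrable_coeFn l).bdd_mul hb hC)]
        refine integral_congr_ae ?_
        filter_upwards [Lp.coeFn_add k l] with x hx
        rw [hx, Pi.add_apply, mul_add]
      map_smul' := fun c k => by
        rw [RingHom.id_apply, smul_eq_mul, ← integral_const_mul]
        refine integral_congr_ae ?_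
        filter_upwards [Lp.coeFn_smul c k] with x hx
        rw [hx, Pi.smul_apply, smul_eq_mul]
        ring } C (fun k => by
      rw [L1.norm_eq_integral_norm, ← integral_const_mul]
      refine norm_integral_le_of_norm_le ((L1.integrable_coeFn k).norm.const_mul C) ?_
      filter_upwards [hC] with x hx
      rw [norm_mul]
      exact mul_le_mul_of_nonneg_right hx (norm_nonneg _))

theorem integralMulL1_apply (b : Ω → ℝ) (hb : AEStronglyMeasurable b ν) (C : ℝ)
    (hC : ∀ᵐ x ∂ν, ‖b x‖ ≤ C) (k : Lp ℝ 1 ν) :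
    integralMulL1 b hb C hC k = ∫ x, b x * k x ∂ν := rfl

variable [IsFiniteMeasure ν]

/-- The inclusion of `L²` in `L¹` over a finite measure. -/
noncomputable def l2ToL1 (ν : Measure Ω) [IsFiniteMeasure ν] : Lp ℝ 2 ν →L[ℝ] Lp ℝ 1 ν :=
  LinearMap.mkContinuous
    { toFun := fun k => ⟨k.1, Lp.antitone (by norm_num) k.2⟩
      map_add' := fun _ _ => rfl
      map_smul' := fun _ _ => rfl } ((ν Set.univ).toReal ^ (1 / 2 : ℝ)) (fun k => by
      have h := eLpNorm_le_eLpNorm_mul_rpow_measure_univ (μ := ν) (p := 1) (q := 2) (by norm_num)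
        (Lp.aestronglyMeasurable k)
      have h1 := ENNReal.toReal_mono (ENNReal.mul_ne_top (Lp.memLp k).2.ne
        (ENNReal.rpow_ne_top_of_nonneg (by norm_num) (measure_ne_top ν _))) h
      rw [ENNReal.toReal_mul, ← ENNReal.toReal_rpow] at h1
      have he : 1 / ENNReal.toReal 1 - 1 / ENNReal.toReal 2 = 1 / 2 := by norm_num
      rw [he, mul_comm] at h1
      exact h1)

theorem coeFn_l2ToL1 (k : Lp ℝ 2 ν) : (l2ToL1 ν k : Ω → ℝ) = k := rfl

/-- The density of a functional on `L¹` of a finite measure, obtained as the Riesz representative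
of its restriction to `L²`. It is bounded by the norm of the functional, see
`ae_abs_dualDensity_le`, but keeping it in `L²` makes the Hilbert space norm available. -/
noncomputable def dualDensity (ν : Measure Ω) [IsFiniteMeasure ν] :
    StrongDual ℝ (Lp ℝ 1 ν) →ₗ[ℝ] Lp ℝ 2 ν where
  toFun φ := (InnerProductSpace.toDual ℝ (Lp ℝ 2 ν)).symm (φ.comp (l2ToL1 ν))
  map_add' φ ψ := by rw [ContinuousLinearMap.add_comp, map_add]
  map_smul' c φ := by
    rw [ContinuousLinearMap.smul_comp, LinearIsometryEquiv.map_smulₛₗ]; rfl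

theorem inner_dualDensity (φ : StrongDual ℝ (Lp ℝ 1 ν)) (k : Lp ℝ 2 ν) :
    inner ℝ (dualDensity ν φ) k = φ (l2ToL1 ν k) :=
  InnerProductSpace.toDual_symm_apply

theorem setIntegral_dualDensity (φ : StrongDual ℝ (Lp ℝ 1 ν)) {s : Set Ω} (hs : MeasurableSet s)
    (c : ℝ) : ∫ x in s, c * dualDensity ν φ x ∂ν =
      φ (indicatorConstLp 1 hs (measure_ne_top ν s) c) := by
  have h1 : l2ToL1 ν (indicatorConstLp 2 hs (measure_ne_top ν s) c) =
      indicatorConstLp 1 hs (measure_ne_top ν s) c := by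
    ext1
    rw [coeFn_l2ToL1]
    exact indicatorConstLp_coeFn.trans indicatorConstLp_coeFn.symm
  rw [← h1, ← inner_dualDensity, real_inner_comm, L2.inner_indicatorConstLp_eq_setIntegral_inner]
  simp [mul_comm]

theorem integrable_dualDensity (φ : StrongDual ℝ (Lp ℝ 1 ν)) :
    Integrable (dualDensity ν φ) ν :=
  (Lp.memLp _).integrable (by norm_num)

theorem ae_abs_dualDensity_le (φ : StrongDual ℝ (Lp ℝ 1 ν)) :
    ∀ᵐ x ∂ν, |dualDensity ν φ x| ≤ ‖φ‖ := by
  have key : ∀ c : ℝ, |c| = 1 → (fun x => c * dualDensity ν φ x) ≤ᵐ[ν] fun _ => ‖φ‖ := by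
    intro c hc
    refine ae_le_of_forall_setIntegral_le ((integrable_dualDensity φ).const_mul c)
      (integrable_const _) fun s hs _ => ?_
    rw [setIntegral_dualDensity φ hs c]
    refine (Real.le_norm_self _).trans ((φ.le_opNorm _).trans_eq ?_)
    rw [norm_indicatorConstLp (by norm_num) (by norm_num)]
    simp [hc, mul_comm]
  filter_upwards [key 1 (by simp), key (-1) (by simp)] with x h1 h2
  exact abs_le'.2 ⟨by simpa using h1, by simpa using h2⟩

theorem apply_eq_integral_dualDensity (φ : StrongDual ℝ (Lp ℝ 1 ν)) (k : Lp ℝ 1 ν) :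
    φ k = ∫ x, dualDensity ν φ x * k x ∂ν := by
  let ψ := integralMulL1 (dualDensity ν φ) (Lp.aestronglyMeasurable _) ‖φ‖
    (ae_abs_dualDensity_le φ)
  change φ k = ψ k
  refine Lp.induction ENNReal.one_ne_top (motive := fun k => φ k = ψ k) ?_ ?_ ?_ k
  · intro c s hs hμ
    rw [Lp.simpleFunc.coe_indicatorConst, ← setIntegral_dualDensity φ hs c, integralMulL1_apply,
      ← integral_indicator hs]
    refine integral_congr_ae ?_
    filter_upwards [indicatorConstLp_coeFn (p := 1) (hs := hs) (hμs := hμ.ne) (c := c)] with x hx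
    rw [hx]
    by_cases h : x ∈ s <;> simp [h, mul_comm]
  · intro f g hf hg _ h1 h2
    rw [map_add, map_add, h1, h2]
  · exact isClosed_eq φ.continuous ψ.continuous

end

section
variable {Ω : Type*} [MeasurableSpace Ω]

theorem withDensitySMulLI_ae {μ : Measure Ω} {h : Ω → NNReal} (hm : Measurable h)
    (u : Lp ℝ 1 (μ.withDensity fun x => h x)) :
    withDensitySMulLI μ (E := ℝ) hm u =ᵐ[μ] fun x => h x • u x := by
  rw [withDensitySMulLI_apply]
  exact MemLp.coeFn_toLp _

/-- A bounded sequence in `L¹(μ)` lies in an isometric copy of `L¹` of a finite measure that is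
the range of an `L`-projection. The finite measure has as density with respect to `μ` a weighted
sum of the functions `|f m|`, and the projection restricts functions to the set where this density
does not vanish. -/
theorem exists_isLProjection_onto_finite {μ : Measure Ω} (f : ℕ → Lp ℝ 1 μ) {C : ℝ}
    (hC : ∀ m, ‖f m‖ ≤ C) :
    ∃ (ν : Measure Ω) (_ : IsFiniteMeasure ν) (J : Lp ℝ 1 ν →ₗᵢ[ℝ] Lp ℝ 1 μ)
      (Q : Lp ℝ 1 μ →L[ℝ] Lp ℝ 1 ν), (∀ g, ‖g‖ = ‖Q g‖ + ‖g - J (Q g)‖) ∧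
        ∀ m, J (Q (f m)) = f m := by
  obtain ⟨ε, hε, hsum⟩ := ENNReal.exists_pos_sum_of_countable' (one_ne_zero (α := ENNReal)) ℕ
  let H : Ω → ENNReal := fun x => ∑' m, ε m * ‖f m x‖ₑ
  have hH : Measurable H := Measurable.tsum fun m => by
    exact ((Lp.stronglyMeasurable (f m)).enorm).const_mul _
  have hHint : ∫⁻ x, H x ∂μ ≠ ⊤ := by
    rw [lintegral_tsum fun m => ((Lp.stronglyMeasurable (f m)).enorm.const_mul _).aemeasurable]
    refine ne_top_of_le_ne_top (b := (∑' m, ε m) * ENNReal.ofReal C)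
      (ENNReal.mul_ne_top hsum.ne_top ENNReal.ofReal_ne_top) ?_
    rw [← ENNReal.tsum_mul_right]
    refine ENNReal.tsum_le_tsum fun m => ?_
    rw [lintegral_const_mul _ (Lp.stronglyMeasurable (f m)).enorm,
      ← L1.ofReal_norm_eq_lintegral]
    gcongr
    exact hC m
  let h : Ω → NNReal := fun x => (H x).toNNReal
  have hm : Measurable h := hH.ennreal_toNNReal
  have hHh : ∀ᵐ x ∂μ, (h x : ENNReal) = H x := by
    filter_upwards [ae_lt_top hH hHint] with x hx
    exact ENNReal.coe_toNNReal hx.ne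
  let ν := μ.withDensity fun x => h x
  have hν : IsFiniteMeasure ν := isFiniteMeasure_withDensity (by rwa [lintegral_congr_ae hHh])
  have hac : ∀ {p : Ω → Prop}, (∀ᵐ x ∂μ, p x) → ∀ᵐ x ∂ν, p x :=
    fun hp => (withDensity_absolutelyContinuous μ _).ae_le hp
  have hind : ∀ g : Ω → ℝ, (fun x => h x • ((h x : ℝ)⁻¹ * g x)) = {x | h x ≠ 0}.indicator g := by
    intro g
    ext x
    by_cases hx : h x = 0
    · simp [hx]
    · have : (h x : ℝ) ≠ 0 := by exact_mod_cast hx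
      simp [hx, NNReal.smul_def]
  have hS : MeasurableSet {x | h x ≠ 0} := (hm (measurableSet_singleton 0)).compl
  have hmem : ∀ g : Lp ℝ 1 μ, MemLp (fun x => (h x : ℝ)⁻¹ * g x) 1 ν := fun g => by
    rw [memLp_one_iff_integrable, integrable_withDensity_iff_integrable_smul hm, hind]
    exact (L1.integrable_coeFn g).indicator hS
  let J := withDensitySMulLI μ (E := ℝ) hm
  let Q₀ : Lp ℝ 1 μ →ₗ[ℝ] Lp ℝ 1 ν :=
    { toFun := fun g => (hmem g).toLp
      map_add' := fun g g' => by
        rw [← MemLp.toLp_add, MemLp.toLp_eq_toLp_iff]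
        filter_upwards [hac (Lp.coeFn_add g g')] with x hx
        simp only [hx, Pi.add_apply, mul_add]
      map_smul' := fun c g => by
        rw [RingHom.id_apply, ← MemLp.toLp_const_smul, MemLp.toLp_eq_toLp_iff]
        filter_upwards [hac (Lp.coeFn_smul c g)] with x hx
        simp only [hx, Pi.smul_apply, smul_eq_mul]
        ring }
  have hJQ : ∀ g, J (Q₀ g) =ᵐ[μ] {x | h x ≠ 0}.indicator g := fun g => by
    refine (withDensitySMulLI_ae hm (Q₀ g)).trans ?_
    rw [← hind]
    filter_upwards [(ae_withDensity_iff hm.coe_nnreal_ennreal).1 ((hmem g).coeFn_toLp)] with x hx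
    by_cases h0 : h x = 0
    · simp [h0]
    · have := hx (by exact_mod_cast h0)
      exact congrArg (h x • ·) this
  have hnorm : ∀ g, ‖g‖ = ‖Q₀ g‖ + ‖g - J (Q₀ g)‖ := fun g => by
    rw [← J.norm_map, L1.norm_eq_integral_norm, L1.norm_eq_integral_norm, L1.norm_eq_integral_norm,
      ← integral_add (L1.integrable_coeFn _).norm (L1.integrable_coeFn _).norm]
    refine integral_congr_ae ?_
    filter_upwards [hJQ g, Lp.coeFn_sub g (J (Q₀ g))] with x h1 h2
    rw [h2, Pi.sub_apply, h1]
    by_cases hx : h x = 0 <;> simp [hx]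
  refine ⟨ν, hν, J, Q₀.mkContinuous 1 (fun g => ?_), fun g => hnorm g, fun m => ?_⟩
  · rw [one_mul, hnorm g]
    linarith [norm_nonneg (g - J (Q₀ g))]
  · ext1
    refine (hJQ (f m)).trans ?_
    filter_upwards [hHh] with x hx
    by_cases h0 : h x = 0
    · have : H x = 0 := by rw [← hx, h0]; rfl
      have := ENNReal.tsum_eq_zero.1 this m
      simp only [mul_eq_zero, (hε m).ne', enorm_eq_zero, false_or] at this
      simp [this]
    · simp [h0]
end

/-! ### Vectors as densities on an `L¹` subspace of the dual -/

section
variable {Ω : Type*} [MeasurableSpace Ω] {ν : Measure Ω}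
  {X : Type*} [NormedAddCommGroup X] [NormedSpace ℝ X]

theorem norm_flip_le (J : Lp ℝ 1 ν →ₗᵢ[ℝ] StrongDual ℝ X) (x : X) :
    ‖J.toContinuousLinearMap.flip x‖ ≤ ‖x‖ :=
  ContinuousLinearMap.opNorm_le_bound _ (norm_nonneg _) fun k => by
    rw [mul_comm]
    simpa using (J k).le_opNorm x

theorem measurableSet_lt_abs (c : ℝ) (k : Lp ℝ 1 ν) : MeasurableSet {ω | c < |k ω|} :=
  measurableSet_lt measurable_const (Lp.stronglyMeasurable k).measurable.abs

variable [IsFiniteMeasure ν]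

theorem norm_dualDensity_le (φ : StrongDual ℝ (Lp ℝ 1 ν)) :
    ‖dualDensity ν φ‖ ≤ ‖φ‖ * ‖l2ToL1 ν‖ :=
  ((InnerProductSpace.toDual ℝ (Lp ℝ 2 ν)).symm.norm_map _).trans_le
    (ContinuousLinearMap.opNorm_comp_le _ _)

/-- For an isometric copy of `L¹(ν)` in the dual of `X`, given by `J`, the density of the
functional `k ↦ J k x` on `L¹(ν)`. -/
noncomputable def evalDensity (J : Lp ℝ 1 ν →ₗᵢ[ℝ] StrongDual ℝ X) : X →ₗ[ℝ] Lp ℝ 2 ν :=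
  dualDensity ν ∘ₗ (J.toContinuousLinearMap.flip : X →ₗ[ℝ] StrongDual ℝ (Lp ℝ 1 ν))

variable (J : Lp ℝ 1 ν →ₗᵢ[ℝ] StrongDual ℝ X)

theorem apply_eq_integral_evalDensity (k : Lp ℝ 1 ν) (x : X) :
    J k x = ∫ ω, evalDensity J x ω * k ω ∂ν :=
  apply_eq_integral_dualDensity (J.toContinuousLinearMap.flip x) k

theorem ae_abs_evalDensity_le (x : X) : ∀ᵐ ω ∂ν, |evalDensity J x ω| ≤ ‖x‖ := by
  filter_upwards [ae_abs_dualDensity_le (J.toContinuousLinearMap.flip x)] with ω h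
  exact h.trans (norm_flip_le J x)

theorem norm_evalDensity_le (x : X) : ‖evalDensity J x‖ ≤ ‖x‖ * ‖l2ToL1 ν‖ :=
  (norm_dualDensity_le _).trans (mul_le_mul_of_nonneg_right (norm_flip_le J x) (norm_nonneg _))

theorem integrable_evalDensity_mul (x : X) {k : Ω → ℝ} (hk : Integrable k ν) :
    Integrable (fun ω => evalDensity J x ω * k ω) ν :=
  hk.bdd_mul (Lp.aestronglyMeasurable _) (ae_abs_evalDensity_le J x)

theorem integrable_abs_evalDensity_mul (x : X) {k : Ω → ℝ} (hk : Integrable k ν) :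
    Integrable (fun ω => |evalDensity J x ω| * |k ω|) ν := by
  simpa [abs_mul] using (integrable_evalDensity_mul J x hk).abs

/-- Splitting `k` at height `c` bounds `J k x` by the `L¹` norm of the density of `x` and the
integral of `|k|` over the set where it is large. -/
theorem abs_apply_le_truncation {c : ℝ} (hc : 0 ≤ c) (k : Lp ℝ 1 ν) (x : X) :
    |J k x| ≤ c * ‖l2ToL1 ν (evalDensity J x)‖ + ‖x‖ * ∫ ω in {ω | c < |k ω|}, |k ω| ∂ν := by
  rw [apply_eq_integral_evalDensity, L1.norm_eq_integral_norm (l2ToL1 ν (evalDensity J x)),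
    ← integral_const_mul, ← integral_const_mul, ← integral_indicator (measurableSet_lt_abs c k),
    ← integral_add]
  · rw [← Real.norm_eq_abs]
    refine norm_integral_le_of_norm_le (Integrable.add ?_ ?_) ?_
    · exact (L1.integrable_coeFn (l2ToL1 ν (evalDensity J x))).norm.const_mul c
    · exact ((L1.integrable_coeFn k).abs.const_mul _).indicator (measurableSet_lt_abs c k)
    · filter_upwards [ae_abs_evalDensity_le J x] with ω h
      rw [norm_mul, coeFn_l2ToL1]
      simp only [Real.norm_eq_abs]
      by_cases hk : c < |k ω|
      · simp only [Set.mem_ofPred_eq, hk, Set.indicator_of_mem]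
        nlinarith [mul_le_mul_of_nonneg_right h (abs_nonneg (k ω)),
          mul_nonneg hc (abs_nonneg (evalDensity J x ω))]
      · simp only [Set.mem_ofPred_eq, hk, not_false_eq_true, Set.indicator_of_notMem]
        nlinarith [mul_le_mul_of_nonneg_left (not_lt.1 hk) (abs_nonneg (evalDensity J x ω))]
  · exact (L1.integrable_coeFn (l2ToL1 ν (evalDensity J x))).norm.const_mul c
  · exact ((L1.integrable_coeFn k).abs.const_mul _).indicator (measurableSet_lt_abs c k)

/-- A uniformly integrable sequence of functionals cannot separate a sequence of vectors in the
manner of James: convex blocks of the vectors with densities close in `L²` are almost identified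
by all functionals of the sequence. -/
theorem not_separated_of_uniformly_integrable (k : ℕ → Lp ℝ 1 ν)
    (hk : ∀ ε > 0, ∃ c, ∀ m, ∫ ω in {ω | c < |k m ω|}, |k m ω| ∂ν ≤ ε) {x : ℕ → X}
    (hx : ∀ n, ‖x n‖ ≤ 1) {θ : ℝ} (hθ : 0 < θ) (h0 : ∀ m n, n < m → J (k m) (x n) = 0)
    (h1 : ∀ m n, m ≤ n → θ < J (k m) (x n)) : False := by
  obtain ⟨c₀, hc₀⟩ := hk (θ / 8) (by positivity)
  obtain ⟨c, hc0, hc⟩ : ∃ c, 0 ≤ c ∧ ∀ m, ∫ ω in {ω | c < |k m ω|}, |k m ω| ∂ν ≤ θ / 8 := by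
    refine ⟨max c₀ 0, le_max_right _ _, fun m => (setIntegral_mono_set
      (L1.integrable_coeFn _).abs.integrableOn (ae_of_all _ fun _ => abs_nonneg _)
      (ae_of_all _ fun ω (hω : _ < _) => ?_)).trans (hc₀ m)⟩
    exact lt_of_le_of_lt (le_max_left _ _) hω
  set K := ‖l2ToL1 ν‖
  have hK : 0 ≤ K := norm_nonneg _
  obtain ⟨p, _, hz, _, hz', hzz⟩ := exists_convexHull_norm_sub_lt
    (u := fun n => evalDensity J (x n)) (C := K)
    (fun n => (norm_evalDensity_le J _).trans (by nlinarith [hx n]))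
    (show 0 < θ / 4 / (c * K + 1) by positivity)
  have himg : ∀ s : Set ℕ, convexHull ℝ ((fun n => evalDensity J (x n)) '' s) =
      evalDensity J '' convexHull ℝ (x '' s) := fun s => by
    rw [LinearMap.image_convexHull, Set.image_image]
  rw [himg] at hz hz'
  obtain ⟨z, hz, rfl⟩ := hz
  obtain ⟨z', hz', rfl⟩ := hz'
  have hball : ∀ s, convexHull ℝ (x '' s) ⊆ Metric.closedBall 0 1 := fun s =>
    convexHull_min (by rintro _ ⟨n, _, rfl⟩; simpa using hx n) (convex_closedBall _ _)
  have e0 : J (k p) z = 0 := by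
    have : convexHull ℝ (x '' Set.Iio p) ⊆ {y | J (k p) y = 0} :=
      convexHull_min (by rintro _ ⟨n, hn, rfl⟩; exact h0 p n hn)
        (convex_hyperplane (J (k p)).toLinearMap.isLinear 0)
    exact this hz
  have e1 : θ ≤ J (k p) z' := by
    have : convexHull ℝ (x '' Set.Ici p) ⊆ {y | θ ≤ J (k p) y} :=
      convexHull_min (by rintro _ ⟨n, hn, rfl⟩; exact (h1 p n hn).le)
        (convex_halfSpace_ge (J (k p)).toLinearMap.isLinear θ)
    exact this hz'
  have hn : ‖z - z'‖ ≤ 2 := by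
    have a := hball _ hz
    have b := hball _ hz'
    rw [mem_closedBall_zero_iff] at a b
    linarith [norm_sub_le z z']
  have key := abs_apply_le_truncation J hc0 (k p) (z - z')
  rw [map_sub, e0] at key
  rw [← map_sub] at hzz
  have hinc := (l2ToL1 ν).le_opNorm (evalDensity J (z - z'))
  rw [lt_div_iff₀ (by positivity)] at hzz
  have h2 : ‖z - z'‖ * ∫ ω in {ω | c < |k p ω|}, |k p ω| ∂ν ≤ 2 * (θ / 8) :=
    mul_le_mul hn (hc p) (integral_nonneg fun _ => abs_nonneg _) (by norm_num)
  have h3 : θ ≤ |0 - J (k p) z'| := by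
    rw [zero_sub, abs_neg]; exact e1.trans (le_abs_self _)
  have h4 := mul_le_mul_of_nonneg_left hinc hc0
  have h5 : c * (K * ‖evalDensity J (z - z')‖) ≤ θ / 4 := by
    nlinarith [norm_nonneg (evalDensity J (z - z'))]
  linarith

end

/-! ### Selecting almost disjoint vectors -/

/-- A Markov type estimate: cutting `A` down to the set where `|u| ≤ η` loses little of the
integral of `|k|`. -/
theorem sub_div_le_setIntegral_inter_abs_le {Ω : Type*} [MeasurableSpace Ω]
    {ν : Measure Ω} {u k : Ω → ℝ} (hu : Measurable u) (hk : Integrable k ν)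
    (huk : Integrable (fun ω => |u ω| * |k ω|) ν) {A : Set Ω} {η : ℝ} (hη : 0 < η) :
    ∫ ω in A, |k ω| ∂ν - (∫ ω, |u ω| * |k ω| ∂ν) / η ≤
      ∫ ω in A ∩ {ω | |u ω| ≤ η}, |k ω| ∂ν := by
  have hm : MeasurableSet {ω | |u ω| ≤ η} := measurableSet_le hu.abs measurable_const
  have h1 := integral_inter_add_sdiff (s := A) hm hk.abs.integrableOn
  have h2 : ∫ ω in A \ {ω | |u ω| ≤ η}, |k ω| ∂ν ≤ (∫ ω, |u ω| * |k ω| ∂ν) / η := by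
    rw [div_eq_inv_mul, ← integral_const_mul]
    calc ∫ ω in A \ {ω | |u ω| ≤ η}, |k ω| ∂ν
        ≤ ∫ ω in {ω | |u ω| ≤ η}ᶜ, |k ω| ∂ν :=
          setIntegral_mono_set hk.abs.integrableOn (ae_of_all _ fun _ => abs_nonneg _)
            (ae_of_all _ fun ω hω => hω.2)
      _ ≤ ∫ ω in {ω | |u ω| ≤ η}ᶜ, η⁻¹ * (|u ω| * |k ω|) ∂ν := by
          refine setIntegral_mono_on hk.abs.integrableOn (huk.const_mul _).integrableOn hm.compl
            fun ω hω => ?_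
          have : η < |u ω| := not_le.1 hω
          rw [← mul_assoc]
          refine le_mul_of_one_le_left (abs_nonneg _) ?_
          rw [inv_mul_eq_div, one_le_div hη]
          exact this.le
      _ ≤ ∫ ω, η⁻¹ * (|u ω| * |k ω|) ∂ν :=
          setIntegral_le_integral (huk.const_mul _) (ae_of_all _ fun ω => by positivity)
  linarith

section
variable {Ω : Type*} [MeasurableSpace Ω] {ν : Measure Ω}
  {X : Type*} [NormedAddCommGroup X] [NormedSpace ℝ X]
  (J : Lp ℝ 1 ν →ₗᵢ[ℝ] StrongDual ℝ X) (Q : StrongDual ℝ X →L[ℝ] Lp ℝ 1 ν)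

/-- The functional `l ↦ ½ ∫_A sgn(k) l` on `L¹`. The sign of `0` is taken to be `1`. -/
noncomputable def halfSignFunctional (A : Set Ω) (hA : MeasurableSet A) (k : Lp ℝ 1 ν) :
    StrongDual ℝ (Lp ℝ 1 ν) :=
  integralMulL1 (A.indicator fun ω => if 0 ≤ k ω then (1 / 2 : ℝ) else -(1 / 2))
    ((Measurable.ite (measurableSet_le measurable_const (Lp.stronglyMeasurable k).measurable)
      measurable_const measurable_const).indicator hA).aestronglyMeasurable (1 / 2)
    (ae_of_all _ fun ω => by
      by_cases h : ω ∈ A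
      · rw [Set.indicator_of_mem h]
        split_ifs <;> simp
      · simp [h])

theorem abs_halfSignFunctional_le {A : Set Ω} (hA : MeasurableSet A) (k l : Lp ℝ 1 ν) :
    |halfSignFunctional A hA k l| ≤ 1 / 2 * ∫ ω in A, |l ω| ∂ν := by
  rw [halfSignFunctional, integralMulL1_apply, ← integral_const_mul, ← integral_indicator hA,
    ← Real.norm_eq_abs]
  refine norm_integral_le_of_norm_le
    (((L1.integrable_coeFn l).abs.const_mul _).indicator hA) (ae_of_all _ fun ω => ?_)
  by_cases h : ω ∈ A
  · rw [Set.indicator_of_mem h, Set.indicator_of_mem h]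
    split_ifs <;> simp
  · simp [h]

theorem halfSignFunctional_self {A : Set Ω} (hA : MeasurableSet A) (k : Lp ℝ 1 ν) :
    halfSignFunctional A hA k k = 1 / 2 * ∫ ω in A, |k ω| ∂ν := by
  rw [halfSignFunctional, integralMulL1_apply, ← integral_const_mul, ← integral_indicator hA]
  congr 1
  ext ω
  by_cases h : ω ∈ A
  · rw [Set.indicator_of_mem h, Set.indicator_of_mem h]
    split_ifs with h0
    · rw [abs_of_nonneg h0]
    · rw [abs_of_neg (not_le.1 h0)]; ring
  · simp [h]

variable [IsFiniteMeasure ν]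

/-- If the densities of the `x i` are jointly smaller than `1 / 2` on disjoint sets `A j`, then
adding to the `x i` half-sign functionals supported on these sets does not increase the bound on
`∑ |f (x i)|`: off `⋃ j, A j` the new terms vanish, and on it each of the two sums is at most half
the mass of `Q f`. -/
theorem sum_abs_add_sum_halfSign_le (hQ : ∀ f, ‖f‖ = ‖Q f‖ + ‖f - J (Q f)‖)
    {ι κ : Type*} [Fintype ι] [Fintype κ] {x : ι → X} {M η : ℝ} (hM : 1 ≤ M)
    (hx : ∀ f : StrongDual ℝ X, ∑ i, |f (x i)| ≤ M * ‖f‖) {A : κ → Set Ω}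
    (hA : ∀ j, MeasurableSet (A j)) (hdisj : Pairwise (Function.onFun Disjoint A))
    (hη : η < 1 / 2) (hs : ∀ j, ∀ᵐ ω ∂ν, ω ∈ A j → ∑ i, |evalDensity J (x i) ω| ≤ η)
    (k : κ → Lp ℝ 1 ν) (f : StrongDual ℝ X) :
    ∑ i, |f (x i)| + ∑ j, |(halfSignFunctional (A j) (hA j) (k j)).comp Q f| ≤ M * ‖f‖ := by
  set B := ⋃ j, A j
  have hB : MeasurableSet B := MeasurableSet.iUnion hA
  set l := Q f with hl
  have hli := L1.integrable_coeFn l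
  have hmem : MemLp (B.indicator l) 1 ν := memLp_one_iff_integrable.2 (hli.indicator hB)
  let lB : Lp ℝ 1 ν := hmem.toLp
  have hlB : lB =ᵐ[ν] B.indicator l := hmem.coeFn_toLp
  have hnB : ‖lB‖ = ∫ ω in B, |l ω| ∂ν := by
    rw [L1.norm_eq_integral_norm, ← integral_indicator hB]
    refine integral_congr_ae ?_
    filter_upwards [hlB] with ω h
    rw [h]
    by_cases h : ω ∈ B <;> simp [h]
  have hnc : ‖l - lB‖ = ‖l‖ - ‖lB‖ := by
    rw [eq_sub_iff_add_eq, L1.norm_eq_integral_norm, L1.norm_eq_integral_norm,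
      L1.norm_eq_integral_norm,
      ← integral_add (L1.integrable_coeFn _).norm (L1.integrable_coeFn _).norm]
    refine integral_congr_ae ?_
    filter_upwards [hlB, Lp.coeFn_sub l lB] with ω h1 h2
    rw [h2, Pi.sub_apply, h1]
    by_cases h : ω ∈ B <;> simp [h]
  have hf' : ‖f - J lB‖ ≤ ‖f‖ - ‖lB‖ := by
    calc ‖f - J lB‖ = ‖(f - J l) + J (l - lB)‖ := by rw [map_sub]; congr 1; abel
      _ ≤ ‖f - J l‖ + ‖J (l - lB)‖ := norm_add_le _ _
      _ = ‖f‖ - ‖lB‖ := by rw [J.norm_map, hnc, hQ f]; ring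
  have hsB : ∀ᵐ ω ∂ν, ω ∈ B → ∑ i, |evalDensity J (x i) ω| ≤ η := by
    filter_upwards [ae_all_iff.2 hs] with ω h hω
    obtain ⟨j, hj⟩ := Set.mem_iUnion.1 hω
    exact h j hj
  have h1 : ∑ i, |J lB (x i)| ≤ 1 / 2 * ‖lB‖ := by
    calc ∑ i, |J lB (x i)| ≤ ∑ i, ∫ ω, |evalDensity J (x i) ω| * |lB ω| ∂ν := by
          refine Finset.sum_le_sum fun i _ => ?_
          rw [apply_eq_integral_evalDensity]
          refine (abs_integral_le_integral_abs).trans_eq ?_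
          simp only [abs_mul]
      _ = ∫ ω, ∑ i, |evalDensity J (x i) ω| * |lB ω| ∂ν :=
          (integral_finsetSum _ fun i _ =>
            integrable_abs_evalDensity_mul J (x i) (L1.integrable_coeFn lB)).symm
      _ ≤ ∫ ω, 1 / 2 * ‖lB ω‖ ∂ν := by
          refine integral_mono_ae (integrable_finsetSum _ fun i _ =>
            integrable_abs_evalDensity_mul J (x i) (L1.integrable_coeFn lB))
            ((L1.integrable_coeFn lB).norm.const_mul _) ?_
          filter_upwards [hsB, hlB] with ω h h'
          simp only [← Finset.sum_mul, Real.norm_eq_abs]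
          by_cases hω : ω ∈ B
          · exact mul_le_mul_of_nonneg_right ((h hω).trans hη.le) (abs_nonneg _)
          · simp [h', hω]
      _ = 1 / 2 * ‖lB‖ := by rw [integral_const_mul, L1.norm_eq_integral_norm]
  have h2 : ∑ j, |(halfSignFunctional (A j) (hA j) (k j)).comp Q f| ≤ 1 / 2 * ‖lB‖ := by
    rw [hnB, integral_iUnion_fintype hA hdisj fun j => hli.abs.integrableOn, Finset.mul_sum]
    exact Finset.sum_le_sum fun j _ => abs_halfSignFunctional_le (hA j) (k j) l
  have h3 : ∑ i, |f (x i)| ≤ ∑ i, |(f - J lB) (x i)| + ∑ i, |J lB (x i)| := by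
    rw [← Finset.sum_add_distrib]
    refine Finset.sum_le_sum fun i _ => ?_
    rw [sub_apply]
    calc |f (x i)| = |(f (x i) - J lB (x i)) + J lB (x i)| := by rw [sub_add_cancel]
      _ ≤ _ := abs_add_le _ _
  have h4 := hx (f - J lB)
  nlinarith [norm_nonneg lB]

/-- A bound for all signed sums of the `y j` is a pointwise bound for the sum of the absolute
values of their densities. -/
theorem ae_sum_abs_evalDensity_le {κ : Type*} [Fintype κ] {y : κ → X} {M : ℝ} (hM : 0 ≤ M)
    (hy : ∀ f : StrongDual ℝ X, ∑ j, |f (y j)| ≤ M * ‖f‖) :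
    ∀ᵐ ω ∂ν, ∑ j, |evalDensity J (y j) ω| ≤ M := by
  classical
  have key : ∀ s : κ → SignType, ∀ᵐ ω ∂ν, ∑ j, (s j : ℝ) * evalDensity J (y j) ω ≤ M := by
    intro s
    have hn : ‖∑ j, (s j : ℝ) • y j‖ ≤ M := by
      refine NormedSpace.norm_le_dual_bound ℝ _ hM fun f => ?_
      rw [map_sum, Real.norm_eq_abs]
      refine (Finset.abs_sum_le_sum_abs _ _).trans ((Finset.sum_le_sum fun j _ => ?_).trans (hy f))
      rw [map_smul, smul_eq_mul, abs_mul]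
      rcases s j with _ | _ | _ <;> simp
    have e : evalDensity J (∑ j, (s j : ℝ) • y j) =ᵐ[ν]
        fun ω => ∑ j, (s j : ℝ) * evalDensity J (y j) ω := by
      rw [map_sum]
      refine (Lp.coeFn_finsetSum _ _).trans ?_
      have : ∀ᵐ ω ∂ν, ∀ j, evalDensity J ((s j : ℝ) • y j) ω = (s j : ℝ) * evalDensity J (y j) ω :=
        ae_all_iff.2 fun j => by
          rw [map_smul]
          exact Lp.coeFn_smul _ _
      filter_upwards [this] with ω h
      rw [Finset.sum_apply]
      exact Finset.sum_congr rfl fun j _ => h j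
    filter_upwards [e, ae_abs_evalDensity_le J (∑ j, (s j : ℝ) • y j)] with ω h1 h2
    rw [← h1]
    exact (le_abs_self _).trans (h2.trans hn)
  filter_upwards [ae_all_iff.2 key] with ω h
  simpa using h fun j => SignType.sign (evalDensity J (y j) ω)

/-- Among many vectors whose signed sums are jointly bounded, one has small density on average
with respect to `|k|`. -/
theorem exists_integral_evalDensity_mul_le {κ : Type*} [Fintype κ] [Nonempty κ] {y : κ → X} {M : ℝ}
    (hM : 0 ≤ M) (hy : ∀ f : StrongDual ℝ X, ∑ j, |f (y j)| ≤ M * ‖f‖) (k : Lp ℝ 1 ν) {C : ℝ}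
    (hC : ‖k‖ ≤ C) : ∃ j, ∫ ω, |evalDensity J (y j) ω| * |k ω| ∂ν ≤ M * C / Fintype.card κ := by
  by_contra! hcon
  have hk := L1.integrable_coeFn k
  have h1 : ∑ j, ∫ ω, |evalDensity J (y j) ω| * |k ω| ∂ν ≤ M * C := by
    rw [← integral_finsetSum _ fun j _ => integrable_abs_evalDensity_mul J (y j) hk]
    refine le_trans ?_ (mul_le_mul_of_nonneg_left hC hM)
    rw [L1.norm_eq_integral_norm, ← integral_const_mul]
    refine integral_mono_ae (integrable_finsetSum _ fun j _ =>
      integrable_abs_evalDensity_mul J (y j) hk) (hk.norm.const_mul _) ?_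
    filter_upwards [ae_sum_abs_evalDensity_le J hM hy] with ω h
    simp only [← Finset.sum_mul, Real.norm_eq_abs]
    exact mul_le_mul_of_nonneg_right h (abs_nonneg _)
  have h2 := Finset.sum_lt_sum_of_nonempty Finset.univ_nonempty
    fun j (_ : j ∈ Finset.univ) => hcon j
  rw [Finset.sum_const, Finset.card_univ, nsmul_eq_mul, mul_div_cancel₀] at h2
  · linarith
  · exact_mod_cast Fintype.card_ne_zero

/-- The induction hypothesis in the construction of a weakly unconditionally Cauchy series: the
signed sums of the vectors of the list `L` have norms less than `2`, and for infinitely many `n`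
the function `k n` has mass more than `δ` on a set `A n`, these sets being disjoint, on which the
absolute values of the densities of the vectors of `L` add up to less than `1 / 2`. -/
def IsExtendable (k : ℕ → Lp ℝ 1 ν) (δ : ℝ) (L : List X) : Prop :=
  (∃ M, 1 ≤ M ∧ M < 2 ∧ ∀ f : StrongDual ℝ X, ∑ i : Fin L.length, |f (L.get i)| ≤ M * ‖f‖) ∧
  ∃ (I : Set ℕ) (A : ℕ → Set Ω) (δ' η : ℝ), I.Infinite ∧ (∀ n, MeasurableSet (A n)) ∧
    Pairwise (Function.onFun Disjoint A) ∧ δ < δ' ∧ η < 1 / 2 ∧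
    (∀ n ∈ I, δ' ≤ ∫ ω in A n, |k n ω| ∂ν) ∧
    ∀ n ∈ I, ∀ᵐ ω ∂ν, ω ∈ A n → ∑ i : Fin L.length, |evalDensity J (L.get i) ω| ≤ η

/-- The induction step in the construction of a weakly unconditionally Cauchy series: local
reflexivity turns many disjointly supported half-sign functionals into vectors of `X`, and by the
pigeonhole principle one of these has small density on most of `A n` for infinitely many `n`. -/
theorem IsExtendable.exists_cons {J : Lp ℝ 1 ν →ₗᵢ[ℝ] StrongDual ℝ X}
    {Q : StrongDual ℝ X →L[ℝ] Lp ℝ 1 ν} (hQ : ∀ f, ‖f‖ = ‖Q f‖ + ‖f - J (Q f)‖)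
    {k : ℕ → Lp ℝ 1 ν} (hQk : ∀ n, Q (J (k n)) = k n) {C : ℝ} (hC : ∀ n, ‖k n‖ ≤ C) {δ : ℝ}
    {L : List X} (hL : IsExtendable J k δ L) :
    ∃ y, IsExtendable J k δ (y :: L) ∧ ∃ n, δ / 2 ≤ J (k n) y := by
  obtain ⟨⟨M, hM1, hM2, hLM⟩, I, A, δ', η, hI, hA, hdisj, hδ, hη, hIA, hLη⟩ := hL
  have hC0 : 0 ≤ C := (norm_nonneg _).trans (hC 0)
  set τ := (1 / 2 - η) / 2 with hτ
  have hτ0 : 0 < τ := by linarith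
  -- With `N` candidates, the sets `A n` lose mass at most `2 * C / N / τ`, which is less than
  -- `δ' - δ`.
  obtain ⟨N, hN⟩ := exists_nat_gt (2 * C / τ / ((δ' - δ) / 2))
  have hN0 : 0 < (N : ℝ) := lt_of_le_of_lt
    (div_nonneg (div_nonneg (by positivity) hτ0.le) (by linarith)) hN
  obtain ⟨F, hFI, hFN⟩ := hI.exists_subset_card_eq N
  have hFcard : (Fintype.card F : ℝ) = N := by simp [hFN]
  have hFne : Nonempty F := by
    rw [← Fintype.card_pos_iff]
    exact_mod_cast hFcard ▸ hN0
  obtain ⟨y, hy, hyk⟩ := local_reflexivity_sum_abs (ε := (2 - M) / 2) (fun i => L.get i)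
    (fun j : F => (halfSignFunctional (A j) (hA j) (k j)).comp Q) (fun j => J (k j))
    (by linarith) (by linarith)
    (sum_abs_add_sum_halfSign_le J Q hQ hM1 hLM (fun j : F => hA j)
      (fun i j hij => hdisj (fun h => hij (Subtype.ext h))) hη (fun j => hLη j (hFI j.2))
      fun j => k j)
  have hy2 : ∀ f : StrongDual ℝ X, ∑ j, |f (y j)| ≤ 2 * ‖f‖ := fun f => by
    have h1 := hy f
    have h2 : 0 ≤ ∑ i : Fin L.length, |f (L.get i)| := Finset.sum_nonneg fun _ _ => abs_nonneg _
    nlinarith [norm_nonneg f]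
  choose j hj using fun n => exists_integral_evalDensity_mul_le J (by norm_num) hy2 (k n) (hC n)
  have : Infinite I := hI.to_subtype
  obtain ⟨j₀, hj₀⟩ := Finite.exists_infinite_fiber fun n : I => j n
  refine ⟨y j₀, ⟨⟨M + (2 - M) / 2, by linarith, by linarith, fun f => ?_⟩,
    {n | n ∈ I ∧ j n = j₀}, fun n => A n ∩ {ω | |evalDensity J (y j₀) ω| ≤ τ},
    δ' - 2 * C / N / τ, η + τ, ?_, ?_, ?_, ?_, by linarith, ?_, ?_⟩, j₀, ?_⟩
  · refine le_trans ?_ (hy f)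
    have h2 := Finset.single_le_sum (f := fun j => |f (y j)|) (fun _ _ => abs_nonneg _)
      (Finset.mem_univ j₀)
    refine (Fin.sum_univ_succ (n := L.length) _).trans_le ?_
    simp only [List.get_cons_zero, List.get_cons_succ']
    linarith
  · have := (Set.infinite_coe_iff.1 hj₀).image (Subtype.val_injective.injOn)
    refine this.mono ?_
    rintro _ ⟨n, hn, rfl⟩
    exact ⟨n.2, hn⟩
  · exact fun n => (hA n).inter (measurableSet_le
      (Lp.stronglyMeasurable _).measurable.abs measurable_const)
  · exact fun m n h => (hdisj h).mono Set.inter_subset_left Set.inter_subset_left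
  · rw [div_lt_iff₀ (by linarith)] at hN
    have : 2 * C / N / τ < δ' - δ := by
      rw [div_right_comm, div_lt_iff₀ hN0]
      nlinarith
    linarith
  · rintro n ⟨hn, rfl⟩
    refine le_trans ?_ (sub_div_le_setIntegral_inter_abs_le (Lp.stronglyMeasurable _).measurable
      (L1.integrable_coeFn (k n)) (integrable_abs_evalDensity_mul J _ (L1.integrable_coeFn (k n)))
      hτ0)
    have h1 := hj n
    rw [hFcard] at h1
    exact sub_le_sub (hIA n hn) (div_le_div_of_nonneg_right h1 hτ0.le)
  · rintro n ⟨hn, rfl⟩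
    filter_upwards [hLη n hn] with ω h hω
    refine (Fin.sum_univ_succ (n := L.length) _).trans_le ?_
    simp only [List.get_cons_zero, List.get_cons_succ']
    linarith [h hω.1, show |evalDensity J (y (j n)) ω| ≤ τ from hω.2]
  · rw [hyk j₀, ContinuousLinearMap.comp_apply, hQk, halfSignFunctional_self]
    linarith [hIA j₀ (hFI j₀.2)]

end

/-! ### Property (V) for preduals of `L¹` -/

section
variable {Ω : Type*} [MeasurableSpace Ω] {ν : Measure Ω}

theorem ofReal_setIntegral_abs (l : Lp ℝ 1 ν) (E : Set Ω) :
    ENNReal.ofReal (∫ ω in E, |l ω| ∂ν) = ∫⁻ ω in E, ‖l ω‖ₑ ∂ν :=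
  ofReal_integral_norm_eq_lintegral_enorm (L1.integrable_coeFn l).integrableOn

theorem eventually_setIntegral_lt_abs_le {k : ℕ → Lp ℝ 1 ν} {C : ℝ} (hC : ∀ m, ‖k m‖ ≤ C)
    (l : Lp ℝ 1 ν) {ε : ℝ} (hε : 0 < ε) :
    ∀ᶠ c in Filter.atTop, ∀ m, ∫ ω in {ω | c < |k m ω|}, |l ω| ∂ν ≤ ε := by
  have hl : ∫⁻ ω, ‖l ω‖ₑ ∂ν ≠ ⊤ := (L1.integrable_coeFn l).2.ne
  obtain ⟨δ, hδ, h⟩ := exists_pos_setLIntegral_lt_of_measure_lt hl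
    (ENNReal.ofReal_pos.2 hε).ne'
  have hC0 : 0 ≤ C := (norm_nonneg _).trans (hC 0)
  obtain ⟨d, hd, hdδ⟩ : ∃ d : ℝ, 0 < d ∧ ENNReal.ofReal d < δ := by
    obtain ⟨d, hd0, hd⟩ := ENNReal.lt_iff_exists_nnreal_btwn.1 hδ
    exact ⟨d, by exact_mod_cast hd0, by simpa using hd⟩
  filter_upwards [Filter.eventually_ge_atTop ((C + 1) / d), Filter.eventually_gt_atTop 0]
    with c hc hc0 m
  have hmarkov := mul_meas_ge_le_integral_of_nonneg (μ := ν) (f := fun ω => |k m ω|)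
    (ae_of_all _ fun _ => abs_nonneg _) (L1.integrable_coeFn (k m)).abs c
  have hle : ν.real {ω | c < |k m ω|} ≤ d := by
    have h1 : ν.real {ω | c < |k m ω|} ≤ ν.real {ω | c ≤ |k m ω|} := by
      refine measureReal_mono (fun ω (h : c < _) => le_of_lt h) ?_
      exact ((L1.integrable_coeFn (k m)).abs.measure_ge_lt_top hc0).ne
    have h2 : ∫ ω, |k m ω| ∂ν ≤ C := by
      have := hC m
      rwa [L1.norm_eq_integral_norm] at this
    rw [div_le_iff₀ hd] at hc
    by_contra! hlt
    nlinarith [mul_lt_mul_of_pos_left (hlt.trans_le h1) hc0]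
  have hfin : ν {ω | c < |k m ω|} ≠ ⊤ :=
    ((L1.integrable_coeFn (k m)).abs.measure_gt_lt_top hc0).ne
  have := h _ (lt_of_le_of_lt ((ENNReal.ofReal_toReal hfin).symm.trans_le
    (ENNReal.ofReal_le_ofReal hle)) hdδ)
  rw [← ofReal_setIntegral_abs] at this
  exact (ENNReal.ofReal_lt_ofReal_iff hε).1 this |>.le

/-- A bounded sequence in `L¹` which is not uniformly integrable has a subsequence (possibly with
repetitions) with masses bounded below on disjoint sets. In the construction, the sets where the
chosen functions are large become so small that the earlier functions have total mass at most `ε /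
2` on the later sets. -/
theorem exists_disjoint_of_not_uniformly_integrable {k : ℕ → Lp ℝ 1 ν} {C : ℝ}
    (hC : ∀ m, ‖k m‖ ≤ C) {ε : ℝ} (hε : 0 < ε)
    (hk : ∀ c, ∃ m, ε < ∫ ω in {ω | c < |k m ω|}, |k m ω| ∂ν) :
    ∃ (φ : ℕ → ℕ) (A : ℕ → Set Ω), (∀ n, MeasurableSet (A n)) ∧
      Pairwise (Function.onFun Disjoint A) ∧ ∀ n, ε / 2 ≤ ∫ ω in A n, |k (φ n) ω| ∂ν := by
  -- The middle component of a triple is a counter, the last one a height.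
  obtain ⟨a, ha, har⟩ := exists_seq_of_forall_finset_exists (α := ℕ × ℕ × ℝ)
    (fun a => ε < ∫ ω in {ω | a.2.2 < |k a.1 ω|}, |k a.1 ω| ∂ν)
    (fun a b => a.2.1 < b.2.1 ∧
      ∫ ω in {ω | b.2.2 < |k b.1 ω|}, |k a.1 ω| ∂ν ≤ ε / 4 * (1 / 2) ^ b.2.1) (by
      intro s _
      have hev : ∀ᶠ c in Filter.atTop, ∀ a ∈ s, ∀ m,
          ∫ ω in {ω | c < |k m ω|}, |k a.1 ω| ∂ν ≤
            ε / 4 * (1 / 2) ^ (s.sup (fun a => a.2.1) + 1) :=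
        (Filter.eventually_all_finset s).2 fun a _ =>
          eventually_setIntegral_lt_abs_le hC (k a.1) (by positivity)
      obtain ⟨c, hc⟩ := hev.exists
      obtain ⟨m, hm⟩ := hk c
      exact ⟨(m, s.sup (fun a => a.2.1) + 1, c), hm, fun b hb =>
        ⟨Nat.lt_succ_of_le (Finset.le_sup (f := fun a : ℕ × ℕ × ℝ => a.2.1) hb), hc b hb m⟩⟩)
  let B : ℕ → Set Ω := fun n => {ω | (a n).2.2 < |k (a n).1 ω|}
  have hB : ∀ n, MeasurableSet (B n) := fun n => measurableSet_lt_abs _ _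
  have hq : StrictMono fun n => (a n).2.1 := fun m n h => (har m n h).1
  let U : ℕ → Set Ω := fun n => ⋃ p, B (n + 1 + p)
  have hU : ∀ n, MeasurableSet (U n) := fun n => MeasurableSet.iUnion fun p => hB _
  refine ⟨fun n => (a n).1, fun n => B n \ U n, fun n => (hB n).diff (hU n), ?_, fun n => ?_⟩
  · have : ∀ m n, m < n → Disjoint (B m \ U m) (B n \ U n) := fun m n h => by
      refine Set.disjoint_left.2 fun ω h1 h2 => h1.2 (Set.mem_iUnion.2 ⟨n - (m + 1), ?_⟩)
      rw [Nat.add_sub_cancel' h]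
      exact h2.1
    intro m n h
    rcases h.lt_or_gt with h | h
    · exact this m n h
    · exact (this n m h).symm
  · set l := k (a n).1 with hl
    have hli := (L1.integrable_coeFn l).abs
    have h1 : ∫ ω in U n, |l ω| ∂ν ≤ ε / 2 := by
      refine (ENNReal.ofReal_le_ofReal_iff (by positivity)).1 ?_
      have hs : Summable fun p : ℕ => ε / 4 * (1 / 2 : ℝ) ^ p :=
        summable_geometric_two.mul_left _
      calc ENNReal.ofReal (∫ ω in U n, |l ω| ∂ν) = ∫⁻ ω in U n, ‖l ω‖ₑ ∂ν :=
            ofReal_setIntegral_abs l _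
        _ ≤ ∑' p, ∫⁻ ω in B (n + 1 + p), ‖l ω‖ₑ ∂ν := lintegral_iUnion_le _ _
        _ ≤ ∑' p : ℕ, ENNReal.ofReal (ε / 4 * (1 / 2) ^ p) := by
            refine ENNReal.tsum_le_tsum fun p => ?_
            rw [← ofReal_setIntegral_abs]
            refine ENNReal.ofReal_le_ofReal ((har n (n + 1 + p) (by omega)).2.trans ?_)
            refine mul_le_mul_of_nonneg_left ?_ (by positivity)
            refine pow_le_pow_of_le_one (by norm_num) (by norm_num) ?_
            exact le_trans (by omega) (hq.le_apply (x := n + 1 + p))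
        _ = ENNReal.ofReal (ε / 2) := by
            rw [← ENNReal.ofReal_tsum_of_nonneg (fun p => by positivity) hs, tsum_mul_left,
              tsum_geometric_two]
            congr 1
            ring
    have h2 := integral_inter_add_sdiff (s := B n) (hU n) hli.integrableOn
    have h3 : ∫ ω in B n ∩ U n, |l ω| ∂ν ≤ ∫ ω in U n, |l ω| ∂ν :=
      setIntegral_mono_set hli.integrableOn (ae_of_all _ fun _ => abs_nonneg _)
        (ae_of_all _ fun ω hω => hω.2)
    have h4 : ε < ∫ ω in B n, |l ω| ∂ν := ha n
    linarith

end

theorem exists_seq_of_forall_exists_cons {α : Type*} {P : List α → Prop} {R : α → Prop}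
    (h0 : P []) (h : ∀ L, P L → ∃ y, P (y :: L) ∧ R y) :
    ∃ (x : ℕ → α) (L : ℕ → List α), L 0 = [] ∧ (∀ n, L (n + 1) = x n :: L n) ∧ (∀ n, P (L n)) ∧
      ∀ n, R (x n) := by
  have : Nonempty α := (h [] h0).nonempty
  choose! y hy hR using h
  let L : ℕ → List α := fun n => Nat.rec [] (fun _ L => y L :: L) n
  have hP : ∀ n, P (L n) := fun n => by
    induction n with
    | zero => exact h0
    | succ n ih => exact hy _ ih
  exact ⟨fun n => y (L n), L, rfl, fun _ => rfl, hP, fun n => hR _ (hP n)⟩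

/-- A Banach space whose dual is isometric to `L¹(μ)` has property (V). -/
theorem hasPropertyV_of_dual_L1 {X : Type u} [NormedAddCommGroup X] [NormedSpace ℝ X]
    [CompleteSpace X] {Ω : Type*} [MeasurableSpace Ω] {μ : Measure Ω}
    (e : StrongDual ℝ X ≃ₗᵢ[ℝ] Lp ℝ 1 μ) : HasPropertyV.{u, t} X := by
  intro Y _ _ _ T hT
  by_contra hnot
  obtain ⟨θ, hθ, f, y, hf, hy, h0, h1⟩ := exists_seq_of_not_isCompact_closure
    (T.lipschitz.isBounded_image Metric.isBounded_closedBall) hnot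
  choose x hx hxy using hy
  obtain rfl : (fun n => T (x n)) = y := funext hxy
  have hg : ∀ m, ‖e ((f m).comp T)‖ ≤ ‖T‖ := fun m => by
    rw [e.norm_map]
    refine (ContinuousLinearMap.opNorm_comp_le _ _).trans ?_
    exact mul_le_of_le_one_left (norm_nonneg _) (hf m)
  obtain ⟨ν, _, J₀, Q₀, hQ₀, hJ₀⟩ := exists_isLProjection_onto_finite _ hg
  let J : Lp ℝ 1 ν →ₗᵢ[ℝ] StrongDual ℝ X := e.symm.toLinearIsometry.comp J₀
  let Q : StrongDual ℝ X →L[ℝ] Lp ℝ 1 ν := Q₀.comp (e : StrongDual ℝ X →L[ℝ] Lp ℝ 1 μ)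
  have hQ : ∀ f, ‖f‖ = ‖Q f‖ + ‖f - J (Q f)‖ := fun f => by
    have h2 : ‖f - J (Q f)‖ = ‖e f - J₀ (Q₀ (e f))‖ := by
      rw [← e.norm_map, map_sub]
      congr 2
      exact e.apply_symm_apply _
    rw [h2, ← e.norm_map f]
    exact hQ₀ (e f)
  let k : ℕ → Lp ℝ 1 ν := fun m => Q ((f m).comp T)
  have hJk : ∀ m, J (k m) = (f m).comp T := fun m =>
    (congrArg e.symm (hJ₀ m)).trans (e.symm_apply_apply _)
  have hQk : ∀ m, Q (J (k m)) = k m := fun m => congrArg Q (hJk m)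
  have hk : ∀ m, ‖k m‖ ≤ ‖T‖ := fun m => by
    rw [← J.norm_map, hJk, ← e.norm_map]
    exact hg m
  by_cases hui : ∀ ε > 0, ∃ c, ∀ m, ∫ ω in {ω | c < |k m ω|}, |k m ω| ∂ν ≤ ε
  · refine not_separated_of_uniformly_integrable J k hui (x := x)
      (fun n => by simpa using hx n) hθ (fun m n hmn => ?_) (fun m n hmn => ?_)
    · rw [hJk]; exact h0 m n hmn
    · rw [hJk]; exact h1 m n hmn
  · push Not at hui
    obtain ⟨ε, hε, hui⟩ := hui
    obtain ⟨φ, A, hA, hdisj, hAε⟩ := exists_disjoint_of_not_uniformly_integrable hk hε hui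
    obtain ⟨z, L, hL0, hLs, hL, hz⟩ := exists_seq_of_forall_exists_cons
      (P := IsExtendable J (fun n => k (φ n)) (ε / 4))
      (R := fun y => ∃ n, ε / 4 / 2 ≤ J (k (φ n)) y)
      ⟨⟨1, le_rfl, by norm_num, fun f => by simp⟩, Set.univ, A, ε / 2, 0, Set.infinite_univ, hA,
        hdisj, by linarith, by norm_num, fun n _ => hAε n,
        fun n _ => ae_of_all _ fun ω _ => by simp⟩
      (fun L hL => hL.exists_cons hQ (fun n => hQk (φ n)) (fun n => hk (φ n)))
    have hsum : ∀ (f : StrongDual ℝ X) n,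
        ∑ i : Fin (L n).length, |f ((L n).get i)| = ∑ i ∈ Finset.range n, |f (z i)| := by
      intro f n
      induction n with
      | zero => rw [hL0]; simp
      | succ n ih =>
        rw [Finset.sum_range_succ, ← ih, hLs, add_comm]
        exact Fin.sum_univ_succ (n := (L n).length) _
    have hw : IsWeaklyUnconditionallyCauchy z := fun f => by
      refine summable_of_sum_range_le (c := 2 * ‖f‖) (fun _ => abs_nonneg _) fun n => ?_
      obtain ⟨⟨M, _, hM, h⟩, _⟩ := hL n
      rw [← hsum]
      exact (h f).trans (mul_le_mul_of_nonneg_right hM.le (norm_nonneg _))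
    have hlim := (hT z hw).tendsto_atTop_zero
    obtain ⟨n, hn⟩ := ((Metric.tendsto_atTop.1 hlim) (ε / 8) (by positivity))
    have hn' := hn n le_rfl
    rw [dist_zero_right] at hn'
    obtain ⟨m, hm⟩ := hz n
    rw [hJk] at hm
    have h3 : f (φ m) (T (z n)) ≤ ‖T (z n)‖ := by
      refine (Real.le_norm_self _).trans (((f (φ m)).le_opNorm _).trans ?_)
      exact mul_le_of_le_one_left (norm_nonneg _) (hf _)
    have : ε / 4 / 2 ≤ f (φ m) (T (z n)) := hm
    linarith

theorem HasPropertyV.of_continuousLinearEquiv {Z : Type u} [NormedAddCommGroup Z] [NormedSpace ℝ Z]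
    [CompleteSpace Z] {W : Type w} [NormedAddCommGroup W] [NormedSpace ℝ W] [CompleteSpace W]
    (e : Z ≃L[ℝ] W) (hW : HasPropertyV.{w, t} W) : HasPropertyV.{u, t} Z := by
  intro Y _ _ _ T hT
  let S : W →L[ℝ] Y := T.comp (e.symm : W →L[ℝ] Z)
  have hS : IsUnconditionallyConverging S := fun x hx => hT _ fun f =>
    hx (f.comp (e.symm : W →L[ℝ] Z))
  have hc : IsCompact _ := hW Y S hS
  obtain ⟨c, hc0, hcb⟩ : ∃ c : ℝ, c ≠ 0 ∧ ∀ z : Z, ‖z‖ ≤ 1 → ‖c⁻¹ • e z‖ ≤ 1 := by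
    have hpos : 0 < ‖(e : Z →L[ℝ] W)‖ + 1 := by positivity
    refine ⟨‖(e : Z →L[ℝ] W)‖ + 1, hpos.ne', fun z hz => ?_⟩
    rw [norm_smul, norm_inv, Real.norm_of_nonneg hpos.le, inv_mul_le_one₀ hpos]
    have := (e : Z →L[ℝ] W).le_opNorm z
    rw [ContinuousLinearEquiv.coe_coe] at this
    nlinarith [norm_nonneg (e : Z →L[ℝ] W)]
  have hcs := hc.image (continuous_const_smul c)
  refine hcs.of_isClosed_subset isClosed_closure (closure_minimal ?_ hcs.isClosed)
  rintro _ ⟨_, ⟨z, hz, rfl⟩, rfl⟩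
  refine ⟨toWeakSpace ℝ Y (S (c⁻¹ • e z)), subset_closure ⟨_, ⟨_, ?_, rfl⟩, rfl⟩, ?_⟩
  · simpa using hcb z (by simpa using hz)
  · change c • _ = _
    rw [← map_smul, ← map_smul, smul_inv_smul₀ hc0]
    simp [S]

section
open Filter Topology

/-! ### The dual of a twisted sum with `c₀` under the supremum norm -/

/-- Renorming along an operator bounded below. The range of the operator is moved to the universe
of `Z` by `Shrink`. -/
theorem exists_continuousLinearEquiv_norm_eq {Z : Type w} [NormedAddCommGroup Z] [NormedSpace ℝ Z]
    [CompleteSpace Z] {E : Type*} [NormedAddCommGroup E] [NormedSpace ℝ E] (S : Z →L[ℝ] E) {c : ℝ}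
    (hS : ∀ z, ‖z‖ ≤ c * ‖S z‖) :
    ∃ (W : Type w) (_ : NormedAddCommGroup W) (_ : NormedSpace ℝ W) (_ : CompleteSpace W)
      (e : Z ≃L[ℝ] W), ∀ z, ‖e z‖ = ‖S z‖ := by
  have hinj : Function.Injective S.toLinearMap := by
    refine (injective_iff_map_eq_zero S).2 fun z hz => norm_le_zero_iff.1 ?_
    simpa [hz] using hS z
  let e₀ : Z ≃ₗ[ℝ] LinearMap.range S.toLinearMap := LinearEquiv.ofInjective S.toLinearMap hinj
  have hsm : Small.{w} (LinearMap.range S.toLinearMap) := small_map e₀.symm.toEquiv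
  let e₁ : Z ≃ₗ[ℝ] Shrink.{w} (LinearMap.range S.toLinearMap) :=
    e₀.trans (Shrink.linearEquiv ℝ _).symm
  have hn : ∀ z, ‖e₁ z‖ = ‖S z‖ := fun z => by
    change ‖(equivShrink _).symm (equivShrink _ (e₀ z))‖ = _
    rw [Equiv.symm_apply_apply]
    rfl
  let e : Z ≃L[ℝ] Shrink.{w} (LinearMap.range S.toLinearMap) :=
    e₁.toContinuousLinearEquivOfBounds ‖S‖ c (fun z => (hn z).trans_le (S.le_opNorm z)) fun w => by
      obtain ⟨z, rfl⟩ := e₁.surjective w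
      rw [hn, e₁.symm_apply_apply]
      exact hS z
  exact ⟨_, inferInstance, inferInstance,
    (completeSpace_congr (e := e.toEquiv) e.isUniformEmbedding).1 inferInstance,
    e, hn⟩

section
variable {W X : Type*} [NormedAddCommGroup W] [NormedSpace ℝ W] [NormedAddCommGroup X]
  [NormedSpace ℝ X]

/-- The norm of `W` is the maximum of `‖P w‖` and `⨆ n, |g n w|`, the map `P` is a metric quotient
map onto `X`, and its kernel is, for complete `W`, a copy of `c₀` with unit vectors `b n` and
coordinates `g n`. Then `W` is the pullback of a contraction `X → ℓ∞ / c₀` and the quotient map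
`ℓ∞ → ℓ∞ / c₀`, with the norm of `X ⊕∞ ℓ∞`. -/
structure IsSupNormExtension (P : W →L[ℝ] X) (g : ℕ → StrongDual ℝ W) (b : ℕ → W) : Prop where
  norm_le_iff : ∀ {w : W} {C : ℝ}, ‖w‖ ≤ C ↔ ‖P w‖ ≤ C ∧ ∀ n, |g n w| ≤ C
  exists_lift : ∀ x, ∃ w, P w = x ∧ ‖w‖ ≤ ‖x‖
  map_basis : ∀ n, P (b n) = 0
  coord_basis : ∀ m n, g m (b n) = if m = n then 1 else 0
  tendsto_coord : ∀ w, P w = 0 → Tendsto (fun n => g n w) atTop (𝓝 0)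

theorem lp_one_hasSum_norm (a : lp (fun _ : ℕ => ℝ) 1) : HasSum (fun n => |a n|) ‖a‖ := by
  simpa using lp.hasSum_norm (p := 1) (by norm_num) a

namespace IsSupNormExtension
variable {P : W →L[ℝ] X} {g : ℕ → StrongDual ℝ W} {b : ℕ → W}

theorem norm_map_le (h : IsSupNormExtension P g b) (w : W) : ‖P w‖ ≤ ‖w‖ :=
  (h.norm_le_iff.1 le_rfl).1

theorem abs_coord_le (h : IsSupNormExtension P g b) (n : ℕ) (w : W) : |g n w| ≤ ‖w‖ :=
  (h.norm_le_iff.1 le_rfl).2 n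

theorem norm_coord_le (h : IsSupNormExtension P g b) (n : ℕ) : ‖g n‖ ≤ 1 :=
  (g n).opNorm_le_bound zero_le_one fun w => by simpa using h.abs_coord_le n w

theorem coord_sum (h : IsSupNormExtension P g b) (c : ℕ → ℝ) (N m : ℕ) :
    g m (∑ n ∈ Finset.range N, c n • b n) = if m < N then c m else 0 := by
  simp [h.coord_basis]

theorem map_sum_basis (h : IsSupNormExtension P g b) (c : ℕ → ℝ) (N : ℕ) :
    P (∑ n ∈ Finset.range N, c n • b n) = 0 := by
  simp [h.map_basis]

theorem norm_sum_basis_le (h : IsSupNormExtension P g b) {c : ℕ → ℝ} (hc : ∀ n, |c n| ≤ 1) (N : ℕ) :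
    ‖∑ n ∈ Finset.range N, c n • b n‖ ≤ 1 := by
  refine h.norm_le_iff.2 ⟨by simp [h.map_sum_basis], fun m => ?_⟩
  rw [h.coord_sum]
  split_ifs
  · exact hc m
  · simp

theorem tendsto_sum_basis (h : IsSupNormExtension P g b) {w : W} (hw : P w = 0) :
    Tendsto (fun N => ∑ n ∈ Finset.range N, g n w • b n) atTop (𝓝 w) := by
  refine Metric.tendsto_atTop.2 fun ε hε => ?_
  obtain ⟨N, hN⟩ := Metric.tendsto_atTop.1 (h.tendsto_coord w hw) (ε / 2) (half_pos hε)
  refine ⟨N, fun M hM => ?_⟩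
  rw [dist_comm, dist_eq_norm_sub]
  refine lt_of_le_of_lt (h.norm_le_iff.2 ⟨?_, fun m => ?_⟩) (half_lt_self hε)
  · rw [map_sub, hw, h.map_sum_basis]; simpa using (half_pos hε).le
  · rw [map_sub, h.coord_sum]
    split_ifs with hm
    · simpa using (half_pos hε).le
    · simpa using (hN m (by omega)).le

theorem summable_smul (h : IsSupNormExtension P g b) (a : lp (fun _ : ℕ => ℝ) 1) :
    Summable fun n => a n • g n := by
  refine Summable.of_norm_bounded (lp_one_hasSum_norm a).summable fun n => ?_
  rw [norm_smul]
  exact mul_le_of_le_one_right (norm_nonneg _) (h.norm_coord_le n)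

theorem hasSum_apply (h : IsSupNormExtension P g b) (a : lp (fun _ : ℕ => ℝ) 1) (w : W) :
    HasSum (fun n => a n * g n w) ((∑' n, a n • g n : StrongDual ℝ W) w) :=
  (h.summable_smul a).hasSum.mapL (ContinuousLinearMap.apply ℝ ℝ w)

/-- The kernel of `P` is an `M`-ideal: to see that the norm is at least `‖a‖ + ‖ψ‖`, lift a vector
almost norming `ψ` and replace finitely many coordinates of the lift by the signs of those of `a`,
which does not increase the norm. -/
theorem norm_tsum_add_comp (h : IsSupNormExtension P g b) (a : lp (fun _ : ℕ => ℝ) 1)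
    (ψ : StrongDual ℝ X) : ‖(∑' n, a n • g n : StrongDual ℝ W) + ψ.comp P‖ = ‖a‖ + ‖ψ‖ := by
  have ha := lp_one_hasSum_norm a
  refine le_antisymm ?_ ?_
  · refine ContinuousLinearMap.opNorm_le_bound _ (by positivity) fun w => ?_
    refine (norm_add_le _ _).trans ?_
    rw [add_mul]
    refine add_le_add ?_ ?_
    · change ‖(∑' n, a n • g n : StrongDual ℝ W) w‖ ≤ _
      rw [← (h.hasSum_apply a w).tsum_eq]
      refine tsum_of_norm_bounded (ha.mul_right ‖w‖) fun n => ?_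
      rw [norm_mul]
      exact mul_le_mul_of_nonneg_left (h.abs_coord_le n w) (norm_nonneg _)
    · exact (ψ.le_opNorm _).trans (mul_le_mul_of_nonneg_left (h.norm_map_le w) (norm_nonneg _))
  · set Φ := (∑' n, a n • g n : StrongDual ℝ W) + ψ.comp P with hΦ
    have key : ∀ x, ‖x‖ ≤ 1 → ‖a‖ + ψ x ≤ ‖Φ‖ := by
      intro x hx
      obtain ⟨w, rfl, hw⟩ := h.exists_lift x
      have hw1 := hw.trans hx
      have hlim : Tendsto (fun N => 2 * ∑ n ∈ Finset.range N, |a n| - ‖a‖ + ψ (P w)) atTop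
          (𝓝 (2 * ‖a‖ - ‖a‖ + ψ (P w))) :=
        ((ha.tendsto_sum_nat.const_mul 2).sub_const _).add_const _
      rw [show 2 * ‖a‖ - ‖a‖ = ‖a‖ by ring] at hlim
      refine le_of_tendsto' hlim fun N => ?_
      let w' := w + ∑ n ∈ Finset.range N, ((SignType.sign (a n) : ℝ) - g n w) • b n
      have hPw : P w' = P w := by simp only [w', map_add, h.map_sum_basis, add_zero]
      have hgw : ∀ m, g m w' = if m < N then (SignType.sign (a m) : ℝ) else g m w := fun m => by
        simp only [w', map_add, h.coord_sum]
        split_ifs <;> ring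
      have hw' : ‖w'‖ ≤ 1 := by
        refine h.norm_le_iff.2 ⟨by rw [hPw]; exact hx, fun m => ?_⟩
        rw [hgw]
        split_ifs
        · rcases SignType.sign (a m) with _ | _ | _ <;> simp
        · exact (h.abs_coord_le m w).trans hw1
      have h1 : Φ w' ≤ ‖Φ‖ := (Real.le_norm_self _).trans
        ((Φ.le_opNorm w').trans (mul_le_of_le_one_right (norm_nonneg _) hw'))
      refine le_trans ?_ h1
      have h2 : 2 * ∑ n ∈ Finset.range N, |a n| - ‖a‖ ≤ (∑' n, a n • g n : StrongDual ℝ W) w' := by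
        have h3 : HasSum (fun n => 2 * (if n < N then |a n| else 0) - |a n|)
            (2 * ∑ n ∈ Finset.range N, |a n| - ‖a‖) := by
          refine HasSum.sub (HasSum.mul_left 2 ?_) ha
          have : HasSum (fun n => if n < N then |a n| else 0)
              (∑ n ∈ Finset.range N, if n < N then |a n| else 0) :=
            hasSum_sum_of_ne_finset_zero fun n hn => if_neg (by simpa using hn)
          rwa [Finset.sum_congr rfl fun n hn => if_pos (Finset.mem_range.1 hn)] at this
        refine hasSum_le (fun n => ?_) h3 (h.hasSum_apply a w')
        rw [hgw]
        split_ifs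
        · rw [mul_comm (a n), sign_mul_self]; linarith
        · have := (h.abs_coord_le n w).trans hw1
          have h5 : |a n * g n w| ≤ |a n| := by
            rw [abs_mul]; exact mul_le_of_le_one_right (abs_nonneg _) this
          linarith [neg_abs_le (a n * g n w)]
      rw [hΦ, add_apply, ContinuousLinearMap.comp_apply, hPw]
      linarith
    have h0 : 0 ≤ ‖Φ‖ - ‖a‖ := by
      have := key 0 (by simp)
      rw [map_zero] at this
      linarith
    have : ‖ψ‖ ≤ ‖Φ‖ - ‖a‖ := by
      refine ContinuousLinearMap.opNorm_le_of_unit_norm h0 fun x hx => ?_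
      refine abs_le'.2 ⟨by linarith [key x hx.le], ?_⟩
      have := key (-x) (by rw [norm_neg, hx])
      rw [map_neg] at this
      linarith
    linarith

theorem exists_eq_tsum_add_comp (h : IsSupNormExtension P g b) (φ : StrongDual ℝ W) :
    ∃ (a : lp (fun _ : ℕ => ℝ) 1) (ψ : StrongDual ℝ X),
      (∑' n, a n • g n : StrongDual ℝ W) + ψ.comp P = φ := by
  have hsum : Summable fun n => |φ (b n)| := by
    refine summable_of_sum_range_le (c := ‖φ‖) (fun _ => abs_nonneg _) fun N => ?_
    have h1 := φ.le_opNorm (∑ n ∈ Finset.range N, (SignType.sign (φ (b n)) : ℝ) • b n)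
    simp only [map_sum, map_smul, smul_eq_mul, sign_mul_self] at h1
    refine (Real.le_norm_self _).trans (h1.trans
      (mul_le_of_le_one_right (norm_nonneg _) (h.norm_sum_basis_le (fun n => ?_) N)))
    rcases SignType.sign (φ (b n)) with _ | _ | _ <;> simp
  let a : lp (fun _ : ℕ => ℝ) 1 := ⟨fun n => φ (b n), memℓp_gen (by simpa using hsum)⟩
  set φ' := φ - ∑' n, a n • g n with hφ'
  have hb : ∀ n, φ' (b n) = 0 := fun n => by
    rw [hφ', sub_apply, ← (h.hasSum_apply a (b n)).tsum_eq,
      tsum_eq_single n fun m hm => by rw [h.coord_basis, if_neg hm, mul_zero]]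
    simp [h.coord_basis, a]
  have hker : ∀ w, P w = 0 → φ' w = 0 := fun w hw => by
    refine tendsto_nhds_unique ((φ'.continuous.tendsto w).comp (h.tendsto_sum_basis hw)) ?_
    simp [Function.comp_def, hb]
  choose s hs hs' using h.exists_lift
  have hφs : ∀ w, φ' (s (P w)) = φ' w := fun w => by
    have := hker (s (P w) - w) (by rw [map_sub, hs, sub_self])
    rwa [map_sub, sub_eq_zero] at this
  let ψ₀ : X →ₗ[ℝ] ℝ :=
    { toFun := fun x => φ' (s x)
      map_add' := fun x y => by
        rw [← map_add, ← hφs (s x + s y), map_add P, hs, hs]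
      map_smul' := fun c x => by
        rw [RingHom.id_apply, ← map_smul, ← hφs (c • s x), map_smul P, hs] }
  refine ⟨a, ψ₀.mkContinuous ‖φ'‖ fun x => (φ'.le_opNorm _).trans
    (mul_le_mul_of_nonneg_left (hs' x) (norm_nonneg _)), ?_⟩
  ext w
  have : φ' (s (P w)) = φ w - (∑' n, a n • g n : StrongDual ℝ W) w := hφs w
  change (∑' n, a n • g n : StrongDual ℝ W) w + φ' (s (P w)) = φ w
  rw [this]
  ring

/-- The dual of `W` is `ℓ₁ ⊕₁ X*`. -/
theorem nonempty_dual_linearIsometryEquiv (h : IsSupNormExtension P g b) :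
    Nonempty (StrongDual ℝ W ≃ₗᵢ[ℝ] WithLp 1 (lp (fun _ : ℕ => ℝ) 1 × StrongDual ℝ X)) := by
  let Ψ : WithLp 1 (lp (fun _ : ℕ => ℝ) 1 × StrongDual ℝ X) →ₗᵢ[ℝ] StrongDual ℝ W :=
    { toFun := fun q => (∑' n, q.fst n • g n) + q.snd.comp P
      map_add' := fun q r => by
        have : ∀ n, (q + r).fst n • g n = q.fst n • g n + r.fst n • g n := fun n => by
          rw [← add_smul]; rfl
        simp only [this]
        rw [(h.summable_smul q.fst).tsum_add (h.summable_smul r.fst), WithLp.add_snd,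
          ContinuousLinearMap.add_comp]
        abel
      map_smul' := fun c q => by
        have : ∀ n, (c • q).fst n • g n = c • q.fst n • g n := fun n => by
          rw [smul_smul]; rfl
        simp only [this]
        rw [(h.summable_smul q.fst).tsum_const_smul c, WithLp.smul_snd,
          ContinuousLinearMap.smul_comp, ← smul_add]
        rfl
      norm_map' := fun q => by
        rw [WithLp.prod_norm_eq_of_L1]
        exact h.norm_tsum_add_comp q.fst q.snd }
  refine ⟨(LinearIsometryEquiv.ofSurjective Ψ fun φ => ?_).symm⟩
  obtain ⟨a, ψ, hφ⟩ := h.exists_eq_tsum_add_comp φ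
  exact ⟨WithLp.toLp 1 (a, ψ), hφ⟩

end IsSupNormExtension
end

/-! ### `L¹` of a disjoint union with the counting measure -/

section
variable {Ω : Type v} [MeasurableSpace Ω]

theorem measurableEmbedding_sumInl {α β : Type*} [MeasurableSpace α] [MeasurableSpace β] :
    MeasurableEmbedding (Sum.inl : α → α ⊕ β) :=
  ⟨Sum.inl_injective, measurable_inl, fun _ hs => measurableSet_inl_image.2 hs⟩

theorem measurableEmbedding_sumInr {α β : Type*} [MeasurableSpace α] [MeasurableSpace β] :
    MeasurableEmbedding (Sum.inr : β → α ⊕ β) :=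
  ⟨Sum.inr_injective, measurable_inr, fun _ hs => measurableSet_inr_image.2 hs⟩

/-- The measure on `ℕ ⊕ Ω` that is the counting measure on `ℕ` and `μ` on `Ω`. -/
noncomputable def countSum (μ : Measure Ω) : Measure (ℕ ⊕ Ω) :=
  Measure.map Sum.inl Measure.count + Measure.map Sum.inr μ

theorem integrable_countSum_iff {μ : Measure Ω} {F : ℕ ⊕ Ω → ℝ} :
    Integrable F (countSum μ) ↔
      (Summable fun n => F (Sum.inl n)) ∧ Integrable (fun ω => F (Sum.inr ω)) μ := by
  rw [countSum, integrable_add_measure, measurableEmbedding_sumInl.integrable_map_iff,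
    measurableEmbedding_sumInr.integrable_map_iff, integrable_count_iff,
    summable_norm_iff]
  rfl

theorem ae_countSum_iff {μ : Measure Ω} {p : ℕ ⊕ Ω → Prop} :
    (∀ᵐ q ∂countSum μ, p q) ↔ (∀ n, p (Sum.inl n)) ∧ ∀ᵐ ω ∂μ, p (Sum.inr ω) := by
  rw [countSum, ae_add_measure_iff, measurableEmbedding_sumInl.ae_map_iff,
    measurableEmbedding_sumInr.ae_map_iff, Measure.ae_count_iff]

theorem integral_countSum {μ : Measure Ω} {F : ℕ ⊕ Ω → ℝ} (hF : Integrable F (countSum μ)) :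
    ∫ q, F q ∂countSum μ = ∑' n, F (Sum.inl n) + ∫ ω, F (Sum.inr ω) ∂μ := by
  have h := hF
  rw [countSum, integrable_add_measure] at h
  rw [countSum, integral_add_measure h.1 h.2, measurableEmbedding_sumInl.integral_map,
    measurableEmbedding_sumInr.integral_map,
    integral_countable (f := fun n => F (Sum.inl n))
      (measurableEmbedding_sumInl.integrable_map_iff.1 h.1)]
  simp [Measure.real]

/-- The `L¹` space of a disjoint union with `ℕ` is `ℓ₁ ⊕₁ L¹(μ)`. -/
theorem nonempty_L1_countSum_linearIsometryEquiv {μ : Measure Ω} {E : Type*} [NormedAddCommGroup E]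
    [NormedSpace ℝ E] (e : E ≃ₗᵢ[ℝ] Lp ℝ 1 μ) :
    Nonempty (WithLp 1 (lp (fun _ : ℕ => ℝ) 1 × E) ≃ₗᵢ[ℝ] Lp ℝ 1 (countSum μ)) := by
  let F : WithLp 1 (lp (fun _ : ℕ => ℝ) 1 × E) → ℕ ⊕ Ω → ℝ := fun q =>
    Sum.elim (fun n => q.fst n) (e q.snd)
  have hF : ∀ q, Integrable (F q) (countSum μ) := fun q => integrable_countSum_iff.2
    ⟨(lp_one_hasSum_norm q.fst).summable.of_abs, L1.integrable_coeFn (e q.snd)⟩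
  let Ψ : WithLp 1 (lp (fun _ : ℕ => ℝ) 1 × E) →ₗᵢ[ℝ] Lp ℝ 1 (countSum μ) :=
    { toFun := fun q => (memLp_one_iff_integrable.2 (hF q)).toLp
      map_add' := fun q r => by
        rw [← MemLp.toLp_add, MemLp.toLp_eq_toLp_iff]
        refine ae_countSum_iff.2 ⟨fun n => rfl, ?_⟩
        have h := Lp.coeFn_add (e q.snd) (e r.snd)
        rw [← map_add] at h
        exact h
      map_smul' := fun c q => by
        rw [RingHom.id_apply, ← MemLp.toLp_const_smul, MemLp.toLp_eq_toLp_iff]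
        refine ae_countSum_iff.2 ⟨fun n => rfl, ?_⟩
        have h := Lp.coeFn_smul c (e q.snd)
        rw [← map_smul] at h
        exact h
      norm_map' := fun q => by
        change ‖(memLp_one_iff_integrable.2 (hF q)).toLp‖ = ‖q‖
        rw [WithLp.prod_norm_eq_of_L1, L1.norm_eq_integral_norm,
          integral_congr_ae ((memLp_one_iff_integrable.2 (hF q)).coeFn_toLp.mono fun _ h =>
            congrArg norm h), integral_countSum (hF q).norm, ← (lp_one_hasSum_norm q.fst).tsum_eq,
          ← e.norm_map, L1.norm_eq_integral_norm]
        rfl }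
  refine ⟨LinearIsometryEquiv.ofSurjective Ψ fun G => ?_⟩
  have hG := integrable_countSum_iff.1 (L1.integrable_coeFn G)
  let a : lp (fun _ : ℕ => ℝ) 1 :=
    ⟨fun n => G (Sum.inl n), memℓp_gen (by simpa using hG.1.abs)⟩
  refine ⟨WithLp.toLp 1 (a, e.symm (memLp_one_iff_integrable.2 hG.2).toLp), ?_⟩
  ext1
  refine (memLp_one_iff_integrable.2 (hF _)).coeFn_toLp.trans (ae_countSum_iff.2 ⟨fun n => rfl, ?_⟩)
  have h : ∀ y, e (e.symm y) = y := e.apply_symm_apply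
  change ∀ᵐ ω ∂μ, e (e.symm _) ω = _
  rw [h]
  exact MemLp.coeFn_toLp _

end

/-! ### Renorming twisted sums with `c₀` -/

/-- The unit vectors of `c₀`. -/
def c0Single (n : ℕ) : C₀(ℕ, ℝ) where
  toFun := Pi.single n 1
  continuous_toFun := continuous_of_discreteTopology
  zero_at_infty' := by
    rw [cocompact_eq_cofinite, Nat.cofinite_eq_atTop]
    refine tendsto_const_nhds.congr' ?_
    filter_upwards [eventually_gt_atTop n] with m hm
    simp [hm.ne']

theorem c0Single_apply (n m : ℕ) : c0Single n m = if m = n then 1 else 0 := by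
  simp [c0Single, Pi.single_apply]

theorem abs_c0_apply_le (y : C₀(ℕ, ℝ)) (n : ℕ) : |y n| ≤ ‖y‖ := by
  rw [← ZeroAtInftyContinuousMap.norm_toBCF_eq_norm]
  exact y.toBCF.norm_coe_le_norm n

theorem norm_c0_le {y : C₀(ℕ, ℝ)} {C : ℝ} (hC : 0 ≤ C) (h : ∀ n, |y n| ≤ C) : ‖y‖ ≤ C := by
  rw [← ZeroAtInftyContinuousMap.norm_toBCF_eq_norm]
  exact (BoundedContinuousFunction.norm_le hC).2 h

theorem tendsto_c0 (y : C₀(ℕ, ℝ)) : Tendsto y atTop (𝓝 0) := by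
  have := y.zero_at_infty'
  rwa [cocompact_eq_cofinite, Nat.cofinite_eq_atTop] at this

section
variable {X Z : Type*} [NormedAddCommGroup X] [NormedSpace ℝ X]
  [NormedAddCommGroup Z] [NormedSpace ℝ Z] [CompleteSpace Z]

/-- The coordinate functionals of the copy of `c₀` extend to a bounded sequence of functionals, by
the Hahn–Banach theorem. Equivalently, the embedding of `c₀` into `ℓ∞` extends to the twisted
sum. -/
theorem IsShortExactSeq.exists_extended_coordinates {j : C₀(ℕ, ℝ) →L[ℝ] Z} {p : Z →L[ℝ] X}
    (h : IsShortExactSeq j p) :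
    ∃ (f : ℕ → StrongDual ℝ Z) (K : ℝ), 0 ≤ K ∧ (∀ n, ‖f n‖ ≤ K) ∧ ∀ n y, f n (j y) = y n := by
  have hr : Set.range j = {z | p z = 0} := by
    ext z; exact (h.exact z).symm
  have hcl : IsClosed (Set.range j) := by
    rw [hr]; exact isClosed_eq p.continuous continuous_const
  let e := j.equivRange h.injective hcl
  let δ : ℕ → StrongDual ℝ C₀(ℕ, ℝ) := fun n =>
    LinearMap.mkContinuous { toFun := fun y => y n
                             map_add' := fun _ _ => rfl
                             map_smul' := fun _ _ => rfl } 1 fun y => by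
        rw [one_mul]; exact abs_c0_apply_le y n
  have hδ : ∀ n, ‖δ n‖ ≤ 1 := fun n => LinearMap.mkContinuous_norm_le _ zero_le_one _
  let es : LinearMap.range j.toLinearMap →L[ℝ] C₀(ℕ, ℝ) := e.symm
  choose f hf hf' using fun n => exists_extension_norm_eq _ ((δ n).comp es)
  refine ⟨f, ‖es‖, ContinuousLinearMap.opNorm_nonneg es, fun n => ?_, fun n y => ?_⟩
  · rw [hf' n]
    exact (ContinuousLinearMap.opNorm_comp_le _ _).trans
      (mul_le_of_le_one_left (norm_nonneg _) (hδ n))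
  · have h1 := hf n (e y)
    have h2 : es (e y) = y := e.symm_apply_apply y
    rw [ContinuousLinearMap.comp_apply, h2] at h1
    exact h1

end

/-- Every twisted sum of `c₀` and `X` has an equivalent norm as in `IsSupNormExtension`. The
extended coordinates `f n` are multiplied by `ε`, so small that they do not exceed `‖x‖` on some
lift of `x`. -/
theorem IsShortExactSeq.exists_renorming {X : Type u} [NormedAddCommGroup X] [NormedSpace ℝ X]
    [CompleteSpace X] {Z : Type w} [NormedAddCommGroup Z] [NormedSpace ℝ Z] [CompleteSpace Z]
    {j : C₀(ℕ, ℝ) →L[ℝ] Z} {p : Z →L[ℝ] X} (h : IsShortExactSeq j p) :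
    ∃ (W : Type w) (_ : NormedAddCommGroup W) (_ : NormedSpace ℝ W) (_ : CompleteSpace W)
      (P : W →L[ℝ] X) (g : ℕ → StrongDual ℝ W) (b : ℕ → W),
      Nonempty (Z ≃L[ℝ] W) ∧ IsSupNormExtension P g b := by
  obtain ⟨f, K, hK, hf, hfj⟩ := h.exists_extended_coordinates
  obtain ⟨C, hC, hlift⟩ := p.exists_preimage_norm_le h.surjective
  have hfz : ∀ n z, |f n z| ≤ K * ‖z‖ := fun n z =>
    ((f n).le_opNorm z).trans (mul_le_mul_of_nonneg_right (hf n) (norm_nonneg _))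
  set ε := (K * C + 1)⁻¹ with hε
  have hε0 : 0 < ε := by positivity
  have hεK : ε * (K * C) ≤ 1 := by
    rw [hε, inv_mul_le_one₀ (by positivity)]; linarith
  let s : Z → BoundedContinuousFunction ℕ ℝ := fun z =>
    BoundedContinuousFunction.ofNormedAddCommGroupDiscrete (fun n => ε * f n z) (ε * (K * ‖z‖))
      fun n => by
        rw [norm_mul, Real.norm_of_nonneg hε0.le]
        exact mul_le_mul_of_nonneg_left (hfz n z) hε0.le
  have hs : ∀ z n, s z n = ε * f n z := fun _ _ => rfl
  let S₂ : Z →L[ℝ] BoundedContinuousFunction ℕ ℝ := LinearMap.mkContinuous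
    { toFun := s
      map_add' := fun z z' => by ext n; simp [hs, mul_add]
      map_smul' := fun c z => by ext n; simp [hs]; ring } (ε * K) fun z =>
        (BoundedContinuousFunction.norm_le (by positivity)).2 fun n => by
          change ‖s z n‖ ≤ _
          rw [hs, norm_mul, Real.norm_of_nonneg hε0.le, mul_assoc]
          exact mul_le_mul_of_nonneg_left (hfz n z) hε0.le
  let S : Z →L[ℝ] X × BoundedContinuousFunction ℕ ℝ := p.prod S₂
  have hS : ∀ z c, 0 ≤ c → (‖S z‖ ≤ c ↔ ‖p z‖ ≤ c ∧ ∀ n, |ε * f n z| ≤ c) := fun z c hc => by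
    rw [Prod.norm_def, max_le_iff]
    exact and_congr Iff.rfl (BoundedContinuousFunction.norm_le hc)
  have hSbd : ∀ z, ‖z‖ ≤ (‖j‖ * (ε⁻¹ + K * C) + C) * ‖S z‖ := fun z => by
    obtain ⟨h1, h2⟩ := (hS z _ (norm_nonneg _)).1 le_rfl
    obtain ⟨z', hz', hz'n⟩ := hlift (p z)
    obtain ⟨y, hy⟩ := (h.exact (z - z')).1 (by rw [map_sub, hz', sub_self])
    have hz'S : ‖z'‖ ≤ C * ‖S z‖ := hz'n.trans (mul_le_mul_of_nonneg_left h1 hC.le)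
    have hyn : ‖y‖ ≤ (ε⁻¹ + K * C) * ‖S z‖ := by
      refine norm_c0_le (by positivity) fun n => ?_
      rw [← hfj, hy, map_sub, add_mul]
      refine (abs_sub _ _).trans (add_le_add ?_ ?_)
      · have := h2 n
        rwa [abs_mul, abs_of_pos hε0, ← le_inv_mul_iff₀ hε0] at this
      · refine (hfz n z').trans ?_
        rw [mul_assoc]
        exact mul_le_mul_of_nonneg_left hz'S hK
    calc ‖z‖ = ‖j y + z'‖ := by rw [hy, sub_add_cancel]
      _ ≤ ‖j‖ * ‖y‖ + ‖z'‖ := (norm_add_le _ _).trans (add_le_add_left (j.le_opNorm y) _)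
      _ ≤ ‖j‖ * ((ε⁻¹ + K * C) * ‖S z‖) + C * ‖S z‖ :=
          add_le_add (mul_le_mul_of_nonneg_left hyn (ContinuousLinearMap.opNorm_nonneg j)) hz'S
      _ = _ := by ring
  obtain ⟨W, _, _, _, e, he⟩ := exists_continuousLinearEquiv_norm_eq S hSbd
  let es : W →L[ℝ] Z := e.symm
  have hes : ∀ z, es (e z) = z := e.symm_apply_apply
  refine ⟨W, inferInstance, inferInstance, inferInstance, p.comp es,
    fun n => ε • (f n).comp es, fun n => e (ε⁻¹ • j (c0Single n)), ⟨e⟩, ?_⟩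
  refine ⟨fun {w C'} => ?_, fun x => ?_, fun n => ?_, fun m n => ?_, fun w hw => ?_⟩
  · obtain ⟨z, rfl⟩ := e.surjective w
    simp only [ContinuousLinearMap.comp_apply, hes, he, smul_apply, smul_eq_mul]
    by_cases hC' : 0 ≤ C'
    · exact hS z C' hC'
    · exact iff_of_false (fun h => hC' ((norm_nonneg _).trans h))
        fun h => hC' ((norm_nonneg _).trans h.1)
  · obtain ⟨z, hz, hzn⟩ := hlift x
    refine ⟨e z, by rw [ContinuousLinearMap.comp_apply, hes, hz], ?_⟩
    rw [he]
    refine (hS z _ (norm_nonneg _)).2 ⟨by rw [hz], fun n => ?_⟩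
    rw [abs_mul, abs_of_pos hε0]
    calc ε * |f n z| ≤ ε * (K * (C * ‖x‖)) := mul_le_mul_of_nonneg_left
          ((hfz n z).trans (mul_le_mul_of_nonneg_left hzn hK)) hε0.le
      _ = ε * (K * C) * ‖x‖ := by ring
      _ ≤ ‖x‖ := mul_le_of_le_one_left (norm_nonneg _) hεK
  · rw [ContinuousLinearMap.comp_apply, hes, map_smul,
      (h.exact _).2 ⟨_, rfl⟩, smul_zero]
  · rw [smul_apply, ContinuousLinearMap.comp_apply, hes, map_smul, hfj, c0Single_apply,
      smul_smul, mul_inv_cancel₀ hε0.ne', one_smul]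
  · obtain ⟨z, rfl⟩ := e.surjective w
    rw [ContinuousLinearMap.comp_apply, hes] at hw
    obtain ⟨y, rfl⟩ := (h.exact z).1 hw
    simp only [smul_apply, ContinuousLinearMap.comp_apply, hes, hfj, smul_eq_mul]
    simpa using (tendsto_c0 y).const_mul ε

end

/-- `Z` is a twisted sum of `c₀ = C₀(ℕ, ℝ)` and the Lindenstrauss space `X`. -/
theorem theorem5p1
    {X : Type u} [NormedAddCommGroup X] [NormedSpace ℝ X] [CompleteSpace X]
    {Z : Type w} [NormedAddCommGroup Z] [NormedSpace ℝ Z] [CompleteSpace Z]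
    (hX : IsLindenstrauss.{u, v} X) (hZ : IsTwistedSum C₀(ℕ, ℝ) X Z) :
    (∃ (W : Type w) (_ : NormedAddCommGroup W) (_ : NormedSpace ℝ W) (_ : CompleteSpace W),
      Nonempty (Z ≃L[ℝ] W) ∧ IsLindenstrauss.{w, v} W ∧
      Nonempty (StrongDual ℝ W ≃ₗᵢ[ℝ]
        WithLp 1 (lp (fun _ : ℕ => ℝ) 1 × StrongDual ℝ X))) ∧
    HasPropertyV.{w, t} Z := by
  obtain ⟨Ω, _, μ, ⟨eX⟩⟩ := hX
  obtain ⟨j, p, hjp⟩ := hZ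
  obtain ⟨W, _, _, _, P, g, b, ⟨e⟩, hW⟩ := hjp.exists_renorming
  obtain ⟨eW⟩ := hW.nonempty_dual_linearIsometryEquiv
  obtain ⟨eL⟩ := nonempty_L1_countSum_linearIsometryEquiv eX
  exact ⟨⟨W, inferInstance, inferInstance, inferInstance, ⟨e⟩,
      ⟨ℕ ⊕ Ω, inferInstance, countSum μ, ⟨eW.trans eL⟩⟩, ⟨eW⟩⟩,
    HasPropertyV.of_continuousLinearEquiv e (hasPropertyV_of_dual_L1 (eW.trans eL))⟩
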